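/- Let $(M,g)$ be a smooth $n$-dimensional Riemannian manifold with Levi-Civita connection $\dot\nabla$, and let $\pi:T^*M\to M$ be its cotangent bundle. For $p\in T^*M$ put $t=\frac12 g^{-1}_{\pi(p)}(p,p)$. For a chart $(x^1,\dots,x^n)$ of $M$ let $(q^1,\dots,q^n,p_1,\dots,p_n)$ be the induced chart of $T^*M$ (so $q^i=x^i\circ\pi$, $p=p_i\,dx^i$). Let $\Gamma^k_{ij}$ be the Christoffel symbols of $\dot\nabla$ ($\dot\nabla_{\partial_i}\partial_j=\Gamma^k_{ij}\partial_k$) and $R^h_{kij}$ the components of its curvature ($R(\partial_i,\partial_j)\partial_k=R^h_{kij}\partial_h$, $R(X,Y)Z=\dot\nabla_X\dot\nabla_YZ-\dot\nabla_Y\dot\nabla_XZ-\dot\nabla_{[X,Y]}Z$). Write $R^0_{kij}=p_hR^h_{kij}$, $g^{0i}=p_hg^{hi}$, $\partial^i=\frac{\partial}{\partial p_i}$, and $\frac{\delta}{\delta q^i}=\frac{\partial}{\partial q^i}+p_k\Gamma^k_{ih}\frac{\partial}{\partial p_h}$. The Einstein summation convention is used throughout. Let $c_1,c_2,c_3,d_1,d_2,d_3:[0,\infty)\to\mathbb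 R$ be smooth functions, and let $G$ be the general natural lifted metric on $T^*M$ given, with respect to horizontal lifts $X^H,Y^H$ of vectors (for the splitting of $TT^*M$ determined by $\dot\nabla$) and vertical lifts $\theta^V,\omega^V$ of covectors, by $$G_p(X^H,Y^H)=c_1(t)\,g(X,Y)+d_1(t)\,p(X)p(Y),$$ $$G_p(\theta^V,\omega^V)=c_2(t)\,g^{-1}(\theta,\omega)+d_2(t)\,g^{-1}(p,\theta)\,g^{-1}(p,\omega),$$ $$G_p(X^H,\theta^V)=G_p(\theta^V,X^H)=c_3(t)\,\theta(X)+d_3(t)\,p(X)\,g^{-1}(p,\theta).$$ Assume that $G$ is positive definite at every point of $T^*M$. In an induced chart put $$G^{(1)}_{ij}=c_1g_{ij}+d_1p_ip_j,\qquad G_{(2)}^{ij}=c_2g^{ij}+d_2g^{0i}g^{0j},\qquad G3^i_j=c_3\delta^i_j+d_3g^{0i}p_j$$ (all coefficients taken at $t$), and let $H_{(1)}^{ij}$, $H3^i_j$, $H^{(2)}_{ij}$ be the blocks of the inverse of the matrix of $G$ in the frame $\{\frac{\delta}{\delta q^i},\frac{\partial}{\partial p_j}\}$: $$\begin{pmatrix}G^{(1)}_{ij}&G3^j_i\\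 G3^i_j&G_{(2)}^{ij}\end{pmatrix}^{-1}=\begin{pmatrix}H_{(1)}^{ij}&H3^i_j\\ H3^j_i&H^{(2)}_{ij}\end{pmatrix}.$$ Then the Levi-Civita connection $\nabla$ of $G$ is given in the adapted frame of every induced chart by $$\nabla_{\frac{\partial}{\partial p_i}}\frac{\partial}{\partial p_j}=Q^{ij}{}_h\frac{\partial}{\partial p_h}+\widetilde Q^{ijh}\frac{\delta}{\delta q^h},\qquad \nabla_{\frac{\delta}{\delta q^i}}\frac{\partial}{\partial p_j}=\bigl(-\Gamma^j_{ih}+\widetilde P_i{}^j{}_h\bigr)\frac{\partial}{\partial p_h}+P_i{}^{jh}\frac{\delta}{\delta q^h},$$ $$\nabla_{\frac{\partial}{\partial p_i}}\frac{\delta}{\delta q^j}=P_j{}^{ih}\frac{\delta}{\delta q^h}+\widetilde P_j{}^i{}_h\frac{\partial}{\partial p_h},\qquad \nabla_{\frac{\delta}{\delta q^i}}\frac{\delta}{\delta q^j}=\bigl(\Gamma^h_{ij}+\widetilde S_{ij}{}^h\bigr)\frac{\delta}{\delta q^h}+S_{ijh}\frac{\partial}{\partial p_h},$$ where $$Q^{ij}{}_h=\tfrac12(\partial^iG_{(2)}^{jk}+\partial^jG_{(2)}^{ik}-\partial^kG_{(2)}^{ij})H^{(2)}_{kh}+\tfrac12(\partial^iG3^j_k+\partial^jG3^i_k)H3^k_h,$$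 $$\widetilde Q^{ijh}=\tfrac12(\partial^iG_{(2)}^{jk}+\partial^jG_{(2)}^{ik}-\partial^kG_{(2)}^{ij})H3^h_k+\tfrac12(\partial^iG3^j_k+\partial^jG3^i_k)H_{(1)}^{kh},$$ $$P_j{}^{ih}=\tfrac12(\partial^iG3^k_j-\partial^kG3^i_j)H3^h_k+\tfrac12(\partial^iG^{(1)}_{jk}-R^0_{ljk}G_{(2)}^{li})H_{(1)}^{kh},$$ $$\widetilde P_j{}^i{}_h=\tfrac12(\partial^iG3^k_j-\partial^kG3^i_j)H^{(2)}_{kh}+\tfrac12(\partial^iG^{(1)}_{jk}-R^0_{ljk}G_{(2)}^{li})H3^k_h,$$ $$S_{ijh}=\tfrac12(c_2\,g^{kl}R^0_{lij}-\partial^kG^{(1)}_{ij})H^{(2)}_{kh}-c_3R^0_{ijk}H3^k_h,$$ $$\widetilde S_{ij}{}^h=\tfrac12(c_2\,g^{kl}R^0_{lij}-\partial^kG^{(1)}_{ij})H3^h_k-c_3R^0_{ijk}H_{(1)}^{kh}.$$ Moreover $Q^{ij}{}_h,\ \widetilde Q^{ijh},\ P_j{}^{ih},\ \widetilde P_j{}^i{}_h,\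 S_{ijh},\ \widetilde S_{ij}{}^h$ are M-tensor fields on $T^*M$: under a change of charts of $M$ they transform like the components of tensor fields on $M$ of the types shown by their indices. -/

import Mathlib

open Bundle Manifold ContDiff Set

namespace NaturalLift

noncomputable section

/-! ### Levi-Civita connections -/

section LeviCivita

variable {E : Type*} [NormedAddCommGroup E] [NormedSpace ℝ E] [FiniteDimensional ℝ E]
  [CompleteSpace E] {H : Type*} [TopologicalSpace H] {I : ModelWithCorners ℝ E H}
  {N : Type*} [TopologicalSpace N] [ChartedSpace H N] [IsManifold I 2 N]

/-- `D` is the Levi-Civita connection of the metric `G` on the manifold `N`: `∇G = 0` and `T = 0`.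
(On paper `D σ x X` is `∇_X σ` at `x`.) -/
structure IsLeviCivita (G : ∀ x : N, TangentSpace I x → TangentSpace I x → ℝ)
    (D : CovariantDerivative I E (TangentSpace I : N → Type _)) : Prop where
  metric : ∀ (x : N) (X : TangentSpace I x) (σ τ : ∀ y : N, TangentSpace I y),
    MDifferentiableAt I I.tangent (fun y => (⟨y, σ y⟩ : TangentBundle I N)) x →
    MDifferentiableAt I I.tangent (fun y => (⟨y, τ y⟩ : TangentBundle I N)) x →
    mvfderiv I (fun y => G y (σ y) (τ y)) x X = G x (D σ x X) (τ x) + G x (σ x) (D τ x X)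
  torsion : D.torsion = 0

/-- The curvature `R(X, Y) Z = ∇_X ∇_Y Z - ∇_Y ∇_X Z - ∇_[X, Y] Z`. -/
def curvature (D : CovariantDerivative I E (TangentSpace I : N → Type _))
    (X Y Z : ∀ y : N, TangentSpace I y) (x : N) : TangentSpace I x :=
  D (fun y => D Z y (Y y)) x (X x) - D (fun y => D Z y (X y)) x (Y x)
    - D Z x (VectorField.mlieBracket I X Y x)

end LeviCivita

/-! ### The base manifold and its cotangent bundle -/

/-- The coordinate space `ℝⁿ`. -/
abbrev Coord (n : ℕ) : Type := EuclideanSpace ℝ (Fin n)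

variable {n : ℕ} {M : Type*} [TopologicalSpace M] [ChartedSpace (Coord n) M]
  [IsManifold (𝓡 n) ∞ M]

variable (n M) in
/-- The total space `T*M` of the cotangent bundle. -/
abbrev Cotangent : Type _ :=
  TotalSpace (Coord n →L[ℝ] ℝ) (fun x : M => TangentSpace (𝓡 n) x →L[ℝ] ℝ)

variable (n) in
/-- The model of the manifold `T*M`. -/
abbrev cotModel : ModelWithCorners ℝ (Coord n × (Coord n →L[ℝ] ℝ))
    (ModelProd (Coord n) (Coord n →L[ℝ] ℝ)) :=
  (𝓡 n).prod 𝓘(ℝ, Coord n →L[ℝ] ℝ)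

variable (n M) in
/-- Connections on the base manifold `M`. -/
abbrev BaseConnection : Type _ :=
  CovariantDerivative (𝓡 n) (Coord n) (TangentSpace (𝓡 n) : M → Type _)

variable (n M) in
/-- Connections on the manifold `T*M`. -/
abbrev CotConnection : Type _ :=
  CovariantDerivative (cotModel n) (Coord n × (Coord n →L[ℝ] ℝ))
    (TangentSpace (cotModel n) : Cotangent n M → Type _)

variable (n M) in
/-- Smooth Riemannian metrics on `M`. -/
abbrev BaseMetric : Type _ :=
  ContMDiffRiemannianMetric (𝓡 n) ∞ (Coord n) (TangentSpace (𝓡 n) : M → Type _)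

/-- The musical isomorphism: `g(θ♯, Y) = θ(Y)`. -/
def sharp (g : BaseMetric n M) (x : M) (θ : TangentSpace (𝓡 n) x →L[ℝ] ℝ) : TangentSpace (𝓡 n) x :=
  (g.inner x).inverse θ

/-- The induced scalar product `g⁻¹(θ, η)` of covectors. -/
def coInner (g : BaseMetric n M) (x : M) (θ η : TangentSpace (𝓡 n) x →L[ℝ] ℝ) : ℝ :=
  θ (sharp g x η)

/-- The energy density `t = ½ g⁻¹(p, p)`. -/
def energy (g : BaseMetric n M) (p : Cotangent n M) : ℝ :=
  coInner g p.proj p.2 p.2 / 2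

/-! ### Horizontal and vertical parts of a tangent vector of `T*M` -/

/-- The differential `π_*` of the projection `π : T*M → M`. -/
def projDeriv (p : Cotangent n M) :
    TangentSpace (cotModel n) p →L[ℝ] TangentSpace (𝓡 n) p.proj :=
  mfderiv (cotModel n) (𝓡 n) (fun q : Cotangent n M => q.proj) p

/-- A vector field `Y` on `M`, regarded as the function `q ↦ q(Y)` on `T*M`. -/
def evalField (Y : ∀ x : M, TangentSpace (𝓡 n) x) (q : Cotangent n M) : ℝ := q.2 (Y q.proj)

theorem mdifferentiableAt_proj (p : Cotangent n M) :
    MDifferentiableAt (cotModel n) (𝓡 n) (fun q : Cotangent n M => q.proj) p :=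
  (contMDiff_proj (n := 1) (IB := 𝓡 n) (F := Coord n →L[ℝ] ℝ)
    (fun x : M => TangentSpace (𝓡 n) x →L[ℝ] ℝ)).mdifferentiableAt (by simp)

theorem mdifferentiableAt_evalField {Y : ∀ x : M, TangentSpace (𝓡 n) x} {p : Cotangent n M}
    (hY : MDifferentiableAt (𝓡 n) (𝓡 n).tangent
      (fun x => (⟨x, Y x⟩ : TangentBundle (𝓡 n) M)) p.proj) :
    MDifferentiableAt (cotModel n) 𝓘(ℝ, ℝ) (evalField Y) p := by
  have h1 : MDifferentiableAt (cotModel n) ((𝓡 n).prod 𝓘(ℝ, Coord n →L[ℝ] ℝ))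
      (fun q : Cotangent n M => TotalSpace.mk' (Coord n →L[ℝ] ℝ)
        (E := fun x : M => TangentSpace (𝓡 n) x →L[ℝ] Bundle.Trivial M ℝ x) q.proj q.2) p :=
    mdifferentiableAt_id (I := cotModel n) (x := p)
  have h2 : MDifferentiableAt (cotModel n) ((𝓡 n).prod 𝓘(ℝ, Coord n))
      (fun q : Cotangent n M => TotalSpace.mk' (Coord n)
        (E := fun x : M => TangentSpace (𝓡 n) x) q.proj (Y q.proj)) p :=
    hY.comp p (mdifferentiableAt_proj p)
  have h3 := MDifferentiableAt.clm_bundle_apply (E₂ := Bundle.Trivial M ℝ)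
    (b := fun q : Cotangent n M => q.proj) (ϕ := fun q => q.2) h1 h2
  rw [mdifferentiableAt_totalSpace] at h3
  exact h3.2

/-- The expression `ξ(q ↦ q(Y)) - p(∇_{π_* ξ} Y)` depends only on the value of `Y` at `π(p)`. -/
theorem tensorialAt_vertPart (D : BaseConnection n M) (p : Cotangent n M)
    (ξ : TangentSpace (cotModel n) p) :
    TensorialAt (𝓡 n) (Coord n) (fun Y : ∀ x : M, TangentSpace (𝓡 n) x =>
      mvfderiv (cotModel n) (evalField Y) p ξ - p.2 (D Y p.proj (projDeriv p ξ))) p.proj where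
  smul := by
    intro f Y hf hY
    have hfp : MDifferentiableAt (cotModel n) 𝓘(ℝ, ℝ) (fun q : Cotangent n M => f q.proj) p :=
      hf.comp p (mdifferentiableAt_proj p)
    have e1 : (evalField (f • Y) : Cotangent n M → ℝ)
        = fun q => f q.proj * evalField Y q := by
      funext q
      simp [evalField]
    have e2 : mvfderiv (cotModel n) (fun q : Cotangent n M => f q.proj) p ξ
        = mvfderiv (𝓡 n) f p.proj (projDeriv p ξ) := by
      have := mfderiv_comp p hf (mdifferentiableAt_proj p)
      have h := congrArg (fun L => L ξ) this
      exact h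
    rw [e1, mvfderiv_fun_mul hfp (mdifferentiableAt_evalField hY),
      D.isCovariantDerivativeOn.leibniz (s := univ) hY hf]
    simp [e2, evalField]
    ring
  add := by
    intro Y Y' hY hY'
    have e1 : (evalField (Y + Y') : Cotangent n M → ℝ)
        = fun q => evalField Y q + evalField Y' q := by
      funext q
      simp [evalField]
    rw [e1, mvfderiv_fun_add (mdifferentiableAt_evalField hY) (mdifferentiableAt_evalField hY'),
      D.isCovariantDerivativeOn.add (s := univ) hY hY']
    simp
    ring

/-- The vertical part of `ξ ∈ T_p(T*M)` with respect to the splitting `V ⊕ H` given by the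
connection `D` on `M`, as a covector at `π(p)`: it maps `Y` to `ξ(q ↦ q(Y)) - p(∇_{π_* ξ} Y)`.
It is `θ` on the vertical lift `θ^V` and zero on horizontal vectors; in an induced chart it is
`dp_h(ξ) - p_k Γ^k_{ih} dq^i(ξ)`. -/
def vertPart (D : BaseConnection n M) (p : Cotangent n M) (ξ : TangentSpace (cotModel n) p) :
    TangentSpace (𝓡 n) p.proj →L[ℝ] ℝ :=
  TensorialAt.mkHom _ p.proj (tensorialAt_vertPart D p ξ)

/-! ### General natural lifted metrics -/

/-- The six smooth functions on `[0, ∞)` which define a general natural lifted metric. -/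
structure Coefficients where
  c₁ : ℝ → ℝ
  c₂ : ℝ → ℝ
  c₃ : ℝ → ℝ
  d₁ : ℝ → ℝ
  d₂ : ℝ → ℝ
  d₃ : ℝ → ℝ
  smooth_c₁ : ContDiffOn ℝ ∞ c₁ (Ici 0)
  smooth_c₂ : ContDiffOn ℝ ∞ c₂ (Ici 0)
  smooth_c₃ : ContDiffOn ℝ ∞ c₃ (Ici 0)
  smooth_d₁ : ContDiffOn ℝ ∞ d₁ (Ici 0)
  smooth_d₂ : ContDiffOn ℝ ∞ d₂ (Ici 0)
  smooth_d₃ : ContDiffOn ℝ ∞ d₃ (Ici 0)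

/-- The general natural lifted metric `G` on `T*M`. A tangent vector with horizontal part `X^H` and
vertical part `θ^V` is paired with one with parts `Y^H` and `η^V`, where
`G(X^H, Y^H) = c₁ g(X, Y) + d₁ p(X) p(Y)`,
`G(θ^V, η^V) = c₂ g⁻¹(θ, η) + d₂ g⁻¹(p, θ) g⁻¹(p, η)`,
`G(X^H, η^V) = G(η^V, X^H) = c₃ η(X) + d₃ p(X) g⁻¹(p, η)`,
with the coefficients taken at the energy density `t` of `p`. -/
def liftMetric (g : BaseMetric n M) (D : BaseConnection n M) (c : Coefficients)
    (p : Cotangent n M) (ξ ζ : TangentSpace (cotModel n) p) : ℝ :=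
  let t := energy g p
  let x := p.proj
  let X := projDeriv p ξ
  let Y := projDeriv p ζ
  let θ := vertPart D p ξ
  let η := vertPart D p ζ
  (c.c₁ t * g.inner x X Y + c.d₁ t * (p.2 X * p.2 Y))
    + (c.c₂ t * coInner g x θ η + c.d₂ t * (coInner g x p.2 θ * coInner g x p.2 η))
    + (c.c₃ t * η X + c.d₃ t * (p.2 X * coInner g x p.2 η))
    + (c.c₃ t * θ Y + c.d₃ t * (p.2 Y * coInner g x p.2 θ))

/-! ### Local charts and the adapted frame

In what follows `e` is a chart `x = (x¹, …, xⁿ)` of `M`. -/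

variable (n M) in
/-- Local charts of `M`, not necessarily members of the given atlas. -/
abbrev Chart : Type _ := OpenPartialHomeomorph M (Coord n)

/-- The coordinate vector field `∂/∂xⁱ` on `M`. -/
def baseFrame (e : Chart n M) (i : Fin n) (x : M) : TangentSpace (𝓡 n) x :=
  VectorField.mpullback (𝓡 n) 𝓘(ℝ, Coord n) e (fun _ => EuclideanSpace.single i 1) x

/-- The value `dxⁱ(X)`. -/
def baseCoframe (e : Chart n M) (i : Fin n) (x : M) (X : TangentSpace (𝓡 n) x) : ℝ :=
  mvfderiv (𝓡 n) e x X i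

/-- The fibre coordinates `p_i` of a covector: `p = p_i dxⁱ`. -/
def fibreCoord (e : Chart n M) (i : Fin n) (p : Cotangent n M) : ℝ :=
  p.2 (baseFrame e i p.proj)

/-- The induced chart `(q¹, …, qⁿ, p₁, …, pₙ)` of `T*M`. -/
def inducedChart (e : Chart n M) (p : Cotangent n M) : Coord n × Coord n :=
  (e p.proj, WithLp.toLp 2 fun i => fibreCoord e i p)

/-- The coordinate vector field `∂/∂qⁱ` on `T*M`. -/
def dq (e : Chart n M) (i : Fin n) (p : Cotangent n M) : TangentSpace (cotModel n) p :=
  VectorField.mpullback (cotModel n) 𝓘(ℝ, Coord n × Coord n) (inducedChart e)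
    (fun _ => ((EuclideanSpace.single i 1, 0) : Coord n × Coord n)) p

/-- The coordinate vector field `∂/∂p_i` on `T*M`. -/
def dp (e : Chart n M) (i : Fin n) (p : Cotangent n M) : TangentSpace (cotModel n) p :=
  VectorField.mpullback (cotModel n) 𝓘(ℝ, Coord n × Coord n) (inducedChart e)
    (fun _ => ((0, EuclideanSpace.single i 1) : Coord n × Coord n)) p

/-- The Christoffel symbols `Γ^k_{ij}` of the connection `D`: `∇_{∂_i} ∂_j = Γ^k_{ij} ∂_k`. -/
def christoffel (D : BaseConnection n M) (e : Chart n M) (k i j : Fin n) (x : M) : ℝ :=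
  baseCoframe e k x (D (baseFrame e j) x (baseFrame e i x))

/-- The components `R^h_{kij}` of the curvature: `R(∂_i, ∂_j) ∂_k = R^h_{kij} ∂_h`. -/
def curvComp (D : BaseConnection n M) (e : Chart n M) (h k i j : Fin n) (x : M) : ℝ :=
  baseCoframe e h x (curvature D (baseFrame e i) (baseFrame e j) (baseFrame e k) x)

/-- `R^0_{kij} = p_h R^h_{kij}`. -/
def curv0 (D : BaseConnection n M) (e : Chart n M) (k i j : Fin n) (p : Cotangent n M) : ℝ :=
  ∑ h, fibreCoord e h p * curvComp D e h k i j p.proj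

/-- The horizontal vector field `δ/δqⁱ = ∂/∂qⁱ + Γ^0_{ih} ∂/∂p_h`, where
`Γ^0_{ih} = p_k Γ^k_{ih}`. -/
def delta (D : BaseConnection n M) (e : Chart n M) (i : Fin n) (p : Cotangent n M) :
    TangentSpace (cotModel n) p :=
  dq e i p + ∑ h, (∑ k, fibreCoord e k p * christoffel D e k i h p.proj) • dp e h p

/-! ### The blocks of the metric and of its inverse -/

/-- The matrix `(g_{ij})`. -/
def gMat (g : BaseMetric n M) (e : Chart n M) (x : M) : Matrix (Fin n) (Fin n) ℝ :=
  .of fun i j => g.inner x (baseFrame e i x) (baseFrame e j x)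

/-- The matrix `(g^{ij})`, inverse to `(g_{ij})`. -/
def gInv (g : BaseMetric n M) (e : Chart n M) (x : M) : Matrix (Fin n) (Fin n) ℝ :=
  (gMat g e x)⁻¹

/-- `g^{0i} = p_h g^{hi}`. -/
def g0 (g : BaseMetric n M) (e : Chart n M) (i : Fin n) (p : Cotangent n M) : ℝ :=
  ∑ h, fibreCoord e h p * gInv g e p.proj h i

section Blocks

variable (g : BaseMetric n M) (c : Coefficients) (e : Chart n M)

/-- `G^{(1)}_{ij} = c₁ g_{ij} + d₁ p_i p_j`, that is, `G(δ/δqⁱ, δ/δqʲ)`. -/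
def G1 (i j : Fin n) (p : Cotangent n M) : ℝ :=
  c.c₁ (energy g p) * gMat g e p.proj i j
    + c.d₁ (energy g p) * (fibreCoord e i p * fibreCoord e j p)

/-- `G_{(2)}^{ij} = c₂ g^{ij} + d₂ g^{0i} g^{0j}`, that is, `G(∂/∂p_i, ∂/∂p_j)`. -/
def G2 (i j : Fin n) (p : Cotangent n M) : ℝ :=
  c.c₂ (energy g p) * gInv g e p.proj i j + c.d₂ (energy g p) * (g0 g e i p * g0 g e j p)

/-- `G3^i_j = c₃ δ^i_j + d₃ g^{0i} p_j`, that is, `G(∂/∂p_i, δ/δqʲ)`. The upper index comes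
first. -/
def G3 (i j : Fin n) (p : Cotangent n M) : ℝ :=
  c.c₃ (energy g p) * (if i = j then 1 else 0)
    + c.d₃ (energy g p) * (g0 g e i p * fibreCoord e j p)

/-- The `2n × 2n` matrix of `G` in the frame `(δ/δqⁱ, ∂/∂p_j)`. -/
def bigMat (p : Cotangent n M) : Matrix (Fin n ⊕ Fin n) (Fin n ⊕ Fin n) ℝ :=
  .fromBlocks (.of fun i j => G1 g c e i j p) (.of fun i j => G3 g c e j i p)
    (.of fun i j => G3 g c e i j p) (.of fun i j => G2 g c e i j p)

/-- The block `H_{(1)}^{kl}` of the inverse matrix. -/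
def H1 (k l : Fin n) (p : Cotangent n M) : ℝ := (bigMat g c e p)⁻¹ (.inl k) (.inl l)

/-- The block `H^{(2)}_{kl}` of the inverse matrix. -/
def H2 (k l : Fin n) (p : Cotangent n M) : ℝ := (bigMat g c e p)⁻¹ (.inr k) (.inr l)

/-- The block `H3^k_l` of the inverse matrix. The upper index comes first. -/
def H3 (k l : Fin n) (p : Cotangent n M) : ℝ := (bigMat g c e p)⁻¹ (.inl k) (.inr l)

end Blocks

/-- The derivative `∂^i f = ∂f/∂p_i` of a function on `T*M`. -/
def pd (e : Chart n M) (i : Fin n) (f : Cotangent n M → ℝ) (p : Cotangent n M) : ℝ :=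
  mvfderiv (cotModel n) f p (dp e i p)

/-! ### The coefficients of the connection -/

section ConnectionCoefficients

variable (g : BaseMetric n M) (D : BaseConnection n M) (c : Coefficients) (e : Chart n M)

/-- `Q^{ij}_h` -/
def Q (i j h : Fin n) (p : Cotangent n M) : ℝ :=
  (1 / 2) * ∑ k, (pd e i (G2 g c e j k) p + pd e j (G2 g c e i k) p - pd e k (G2 g c e i j) p)
      * H2 g c e k h p
    + (1 / 2) * ∑ k, (pd e i (G3 g c e j k) p + pd e j (G3 g c e i k) p) * H3 g c e k h p

/-- `Q̃^{ijh}` -/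
def Qt (i j h : Fin n) (p : Cotangent n M) : ℝ :=
  (1 / 2) * ∑ k, (pd e i (G2 g c e j k) p + pd e j (G2 g c e i k) p - pd e k (G2 g c e i j) p)
      * H3 g c e h k p
    + (1 / 2) * ∑ k, (pd e i (G3 g c e j k) p + pd e j (G3 g c e i k) p) * H1 g c e k h p

/-- `P_j^{ih}` -/
def P (j i h : Fin n) (p : Cotangent n M) : ℝ :=
  (1 / 2) * ∑ k, (pd e i (G3 g c e k j) p - pd e k (G3 g c e i j) p) * H3 g c e h k p
    + (1 / 2) * ∑ k, (pd e i (G1 g c e j k) p - ∑ l, curv0 D e l j k p * G2 g c e l i p)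
      * H1 g c e k h p

/-- `P̃_j^i_h` -/
def Pt (j i h : Fin n) (p : Cotangent n M) : ℝ :=
  (1 / 2) * ∑ k, (pd e i (G3 g c e k j) p - pd e k (G3 g c e i j) p) * H2 g c e k h p
    + (1 / 2) * ∑ k, (pd e i (G1 g c e j k) p - ∑ l, curv0 D e l j k p * G2 g c e l i p)
      * H3 g c e k h p

/-- `S_{ijh}` -/
def S (i j h : Fin n) (p : Cotangent n M) : ℝ :=
  (1 / 2) * ∑ k, (c.c₂ (energy g p) * (∑ l, gInv g e p.proj k l * curv0 D e l i j p)
      - pd e k (G1 g c e i j) p) * H2 g c e k h p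
    - c.c₃ (energy g p) * ∑ k, curv0 D e i j k p * H3 g c e k h p

/-- `S̃_{ij}^h` -/
def St (i j h : Fin n) (p : Cotangent n M) : ℝ :=
  (1 / 2) * ∑ k, (c.c₂ (energy g p) * (∑ l, gInv g e p.proj k l * curv0 D e l i j p)
      - pd e k (G1 g c e i j) p) * H3 g c e h k p
    - c.c₃ (energy g p) * ∑ k, curv0 D e i j k p * H1 g c e k h p

end ConnectionCoefficients

/-! ### M-tensor fields -/

/-- The variance of an index: contravariant (upper) or covariant (lower). -/
inductive Variance
  | upper
  | lower

/-- The factor by which an index is transformed when passing from the chart `e` to `e'`: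
`∂x'^i/∂x^a` for an upper index, `∂x^a/∂x'^i` for a lower one. -/
def transition (e e' : Chart n M) (x : M) (i a : Fin n) : Variance → ℝ
  | .upper => baseCoframe e' i x (baseFrame e a x)
  | .lower => baseCoframe e a x (baseFrame e' i x)

/-- A family of components `T e i j k`, one system of functions of `(q, p)` for each chart `e` of
`M`, is an M-tensor field on `T*M` with three indices of the variances `v₁`, `v₂`, `v₃`: under a
change of charts it transforms like the components of a tensor field on `M`. -/
def IsMTensorField (v₁ v₂ v₃ : Variance)
    (T : Chart n M → Fin n → Fin n → Fin n → Cotangent n M → ℝ) : Prop :=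
  ∀ e ∈ IsManifold.maximalAtlas (𝓡 n) ∞ M, ∀ e' ∈ IsManifold.maximalAtlas (𝓡 n) ∞ M,
    ∀ p : Cotangent n M, p.proj ∈ e.source → p.proj ∈ e'.source → ∀ i j k : Fin n,
      T e' i j k p = ∑ a, ∑ b, ∑ d, transition e e' p.proj i a v₁ * transition e e' p.proj j b v₂
        * transition e e' p.proj k d v₃ * T e a b d p

end

end NaturalLift

/-!
The four formulas come from the Koszul formula for `∇` on the vectors of the adapted frame
`(δ/δqⁱ, ∂/∂p_j)`. Since `G` is nondegenerate, a tangent vector is determined by its scalar products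
with the frame, through the inverse matrix (`eq_sum_of_liftMetric`), so everything reduces to
computing these products for the covariant derivatives. The Koszul formula needs two ingredients.

* The brackets of the frame: `[∂^i, ∂^j] = 0`, `[∂^i, δ_j] = Γ^i_{jh} ∂^h` and
  `[δ_i, δ_j] = R^0_{hij} ∂^h` (`mlieBracket_dp_dp`, `mlieBracket_dp_delta`,
  `mlieBracket_delta_delta`). They are all vertical, hence found by applying them to the fibre
  coordinates.
* The derivatives of the blocks of `G` in the direction `δ_k`. Moving along `δ_k` transports `p`
  parallelly, so the energy density `t` and the functions `c_i(t)`, `d_i(t)` are constant, and `δ_k`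
  acts on `G^{(1)}`, `G_{(2)}`, `G3` by Christoffel terms only, one for each index
  (`hasDirDeriv_G1_delta`, `hasDirDeriv_G2_delta`, `hasDirDeriv_G3_delta`).

The Christoffel terms of the two ingredients cancel in `∇_{∂^i} ∂^j` and `∇_{∂^i} δ_j`, while
`∇_{δ_i} δ_j` keeps `Γ^h_{ij} δ_h`. The remaining derivative `∇_{δ_i} ∂^j` differs from `∇_{∂^j} δ_i`
by the bracket `[δ_i, ∂^j] = -Γ^j_{ih} ∂^h`.

The curvature terms simplify by the first Bianchi identity (`curv0_bianchi`) and by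
`g^{0h} R^0_{hij} = 0` (`sum_curv0_mul_g0`), which kills the terms with `d_2` and `d_3`. The latter
holds because `t` is constant along horizontal fields, hence along `[δ_i, δ_j]`.

The transformation laws are read off from the formulas. Under a change of charts the two halves of
the frame are multiplied by the Jacobian matrix and its inverse, which are functions on the base and
so constant in vertical directions. Thus `∇_{∂^i} ∂^j` and `∇_{∂^i} δ_j` transform like tensors. The
derivative of the Jacobian that appears in `∇_{δ_i} δ_j` appears in the horizontal lift of
`∇_{∂_i} ∂_j` as well, and the difference of the two transforms like a tensor. The components of such
families are M-tensor fields (`isMTensorField_of_expansion`).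
-/

namespace NaturalLift

noncomputable section

/-! ### Derivatives of functions along vector fields -/

section Manifolds

variable {E : Type*} [NormedAddCommGroup E] [NormedSpace ℝ E]
  {H : Type*} [TopologicalSpace H] {I : ModelWithCorners ℝ E H}
  {N : Type*} [TopologicalSpace N] [ChartedSpace H N] [IsManifold I ∞ N]

theorem two_le_infty : (2 : WithTop ℕ∞) ≤ ∞ := WithTop.coe_le_coe.2 le_top

omit [IsManifold I ∞ N] in
theorem mvfderiv_congr {F : Type*} [NormedAddCommGroup F] [NormedSpace ℝ F]
    {f f' : N → F} {x : N} (h : f =ᶠ[nhds x] f') : mvfderiv I f x = mvfderiv I f' x := by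
  unfold mvfderiv
  rw [h.mfderiv_eq]
  rfl

theorem mvfderiv_eq_fderiv {E F : Type*} [NormedAddCommGroup E] [NormedSpace ℝ E]
    [NormedAddCommGroup F] [NormedSpace ℝ F] (f : E → F) (x : E) :
    mvfderiv 𝓘(ℝ, E) f x = fderiv ℝ f x := by
  ext v
  simp only [mvfderiv, mfderiv_eq_fderiv]
  rfl

theorem contMDiffAt_mvfderiv {f : N → ℝ} {x : N} (hf : ContMDiffAt I 𝓘(ℝ, ℝ) ∞ f x) :
    ContMDiffAt I (I.prod 𝓘(ℝ, E →L[ℝ] ℝ)) ∞ (fun y => TotalSpace.mk' (E →L[ℝ] ℝ)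
      (E := fun x : N => TangentSpace I x →L[ℝ] Bundle.Trivial N ℝ x) y (mvfderiv I f y)) x := by
  rw [contMDiffAt_hom_bundle]
  refine ⟨contMDiffAt_id, ?_⟩
  refine (hf.mfderiv_const (m := ∞) (by simp)).congr_of_eventuallyEq ?_
  filter_upwards with y
  ext v
  simp [inTangentCoordinates, ContinuousLinearMap.inCoordinates, mvfderiv]
  rfl

theorem contMDiffAt_mvfderiv_apply {f : N → ℝ} {V : ∀ y : N, TangentSpace I y} {x : N}
    (hf : ContMDiffAt I 𝓘(ℝ, ℝ) ∞ f x)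
    (hV : ContMDiffAt I I.tangent ∞ (fun y => (⟨y, V y⟩ : TangentBundle I N)) x) :
    ContMDiffAt I 𝓘(ℝ, ℝ) ∞ (fun y => mvfderiv I f y (V y)) x := by
  have h3 := ContMDiffAt.clm_bundle_apply (E₂ := Bundle.Trivial N ℝ)
    (b := fun y : N => y) (contMDiffAt_mvfderiv hf) hV
  rw [contMDiffAt_totalSpace] at h3
  exact h3.2

/-- The bracket of vector fields is the commutator of the derivations: `[V, W] f = V (W f) - W (V f)`.
In an extended chart this is the symmetry of the second derivative. -/
theorem mvfderiv_mlieBracket [CompleteSpace E] [I.Boundaryless] {f : N → ℝ}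
    {V W : ∀ y : N, TangentSpace I y} {x : N}
    (hf : ContMDiffAt I 𝓘(ℝ, ℝ) ∞ f x)
    (hV : MDifferentiableAt I I.tangent (fun y => (⟨y, V y⟩ : TangentBundle I N)) x)
    (hW : MDifferentiableAt I I.tangent (fun y => (⟨y, W y⟩ : TangentBundle I N)) x) :
    mvfderiv I f x (VectorField.mlieBracket I V W x)
      = mvfderiv I (fun y => mvfderiv I f y (W y)) x (V x)
        - mvfderiv I (fun y => mvfderiv I f y (V y)) x (W x) := by
  set φ := extChartAt I x with hφ
  set F : E → ℝ := f ∘ φ.symm with hF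
  set A : ∀ y : N, TangentSpace I y →L[ℝ] E := fun y => mvfderiv I φ y with hA
  have hAi : ∀ y ∈ (extChartAt I x).source, ∀ w : E,
      A y ((mfderiv I 𝓘(ℝ, E) (extChartAt I x) y).inverse w) = w := fun y hy w =>
    (isInvertible_mfderiv_extChartAt hy).self_apply_inverse w
  have hFs : ContDiffAt ℝ ∞ F (φ x) := by
    rw [← contMDiffAt_iff_contDiffAt]
    refine ContMDiffAt.comp (φ x) (I' := I) (by rwa [extChartAt_to_inv x]) ?_
    have := contMDiffWithinAt_extChartAt_symm_range_self (I := I) (n := ∞) x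
    rwa [I.range_eq_univ] at this
  have hdF : ∀ᶠ y in nhds x, ∀ v, mvfderiv I f y v = fderiv ℝ F (φ y) (A y v) := by
    have h1 : ∀ᶠ z in nhds (φ x), ContDiffAt ℝ 2 F z :=
      (hFs.of_le two_le_infty).eventually (by simp)
    have h2 := (continuousAt_extChartAt (I := I) x).eventually h1
    filter_upwards [h2, extChartAt_source_mem_nhds (I := I) x] with y hy hys v
    have hfe : f =ᶠ[nhds y] F ∘ φ := by
      filter_upwards [(isOpen_extChartAt_source (I := I) x).mem_nhds hys] with z hz
      simp only [F, φ, Function.comp_apply, (extChartAt I x).left_inv hz]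
    have hFd : MDifferentiableAt 𝓘(ℝ, E) 𝓘(ℝ, ℝ) F (φ y) :=
      (hy.differentiableAt (by simp)).mdifferentiableAt
    have hφd : MDifferentiableAt I 𝓘(ℝ, E) φ y :=
      mdifferentiableAt_extChartAt (by simpa using hys)
    rw [mvfderiv_congr hfe, mvfderiv_comp_apply y hFd hφd, mvfderiv_eq_fderiv]
    rfl
  -- a field `U` is represented in the chart by a field `U'` on `E`, and `U f` by `dF(U')`
  have key : ∀ U : (∀ y : N, TangentSpace I y),
      MDifferentiableAt I I.tangent (fun y => (⟨y, U y⟩ : TangentBundle I N)) x →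
      ∃ U' : E → E, U' = VectorField.mpullbackWithin 𝓘(ℝ, E) I φ.symm U (range I) ∧
      DifferentiableAt ℝ U' (φ x) ∧ U' (φ x) = A x (U x) ∧
      (fun y => mvfderiv I f y (U y)) =ᶠ[nhds x] (fun z => fderiv ℝ F z (U' z)) ∘ φ := by
    intro U hU
    have hU' := VectorField.eventuallyEq_mpullback_mpullbackWithin_extChartAt (I := I)
      (s := univ) (x := x) U
    rw [nhdsWithin_univ] at hU'
    set U' : E → E := VectorField.mpullbackWithin 𝓘(ℝ, E) I φ.symm U (range I) with hUdef
    refine ⟨U', rfl, ?_, ?_, ?_⟩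
    · have : DifferentiableWithinAt ℝ U' (φ.symm ⁻¹' univ ∩ range I) (φ x) :=
        (mdifferentiableWithinAt_univ.2 hU).differentiableWithinAt_mpullbackWithin_vectorField
      rw [preimage_univ, univ_inter, I.range_eq_univ] at this
      exact differentiableWithinAt_univ.1 this
    · have := hU'.eq_of_nhds
      rw [VectorField.mpullback_apply] at this
      rw [this]
      exact (hAi x (mem_extChartAt_source x) _).symm
    · filter_upwards [hU', hdF, extChartAt_source_mem_nhds (I := I) x] with y h1 h2 h3
      rw [VectorField.mpullback_apply] at h1
      rw [h2, h1]
      exact congrArg _ (hAi y h3 _)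
  have key2 : ∀ (U' : E → E) (v : TangentSpace I x) (u : N → ℝ), DifferentiableAt ℝ U' (φ x) →
      u =ᶠ[nhds x] (fun z => fderiv ℝ F z (U' z)) ∘ φ →
      mvfderiv I u x v = fderiv ℝ (fderiv ℝ F) (φ x) (A x v) (U' (φ x))
        + fderiv ℝ F (φ x) (fderiv ℝ U' (φ x) (A x v)) := by
    intro U' v u hU' hu
    have hd : DifferentiableAt ℝ (fderiv ℝ F) (φ x) :=
      (hFs.fderiv_right (m := 1) (by rw [one_add_one_eq_two]; exact two_le_infty)).differentiableAt
        one_ne_zero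
    rw [mvfderiv_congr hu, mvfderiv_comp_apply x (hd.clm_apply hU').mdifferentiableAt
      (mdifferentiableAt_extChartAt (mem_chart_source H x)), mvfderiv_eq_fderiv,
      fderiv_clm_apply hd hU', add_comm]
    rfl
  obtain ⟨V', hV', dV', eV', fV'⟩ := key V hV
  obtain ⟨W', hW', dW', eW', fW'⟩ := key W hW
  rw [key2 V' _ _ dV' fV', key2 W' _ _ dW' fW', ← eV', ← eW']
  have hs : IsSymmSndFDerivAt ℝ F (φ x) := hFs.isSymmSndFDerivAt (by simpa using two_le_infty)
  have hb : A x (VectorField.mlieBracket I V W x)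
      = VectorField.lieBracket ℝ V' W' (φ x) := by
    rw [← VectorField.mlieBracketWithin_univ, VectorField.mlieBracketWithin_apply]
    refine (hAi x (mem_extChartAt_source x) _).trans ?_
    rw [preimage_univ, univ_inter, ← hV', ← hW', I.range_eq_univ,
      VectorField.lieBracketWithin_univ]
  rw [hdF.self_of_nhds, hb, VectorField.lieBracket_eq, hs.eq (V' (φ x)) (W' (φ x))]
  simp

end Manifolds

/-! ### Connections and the Koszul formula -/

section Connections

variable {E : Type*} [NormedAddCommGroup E] [NormedSpace ℝ E]
  {H : Type*} [TopologicalSpace H] {I : ModelWithCorners ℝ E H}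
  {N : Type*} [TopologicalSpace N] [ChartedSpace H N] [IsManifold I 2 N]

variable (I) in
/-- The vector field `V` is differentiable at `x`. -/
abbrev DiffFieldAt (V : ∀ y : N, TangentSpace I y) (x : N) : Prop :=
  MDifferentiableAt I I.tangent (fun y => (⟨y, V y⟩ : TangentBundle I N)) x

variable (I) in
/-- The vector field `V` is smooth at `x`. -/
abbrev SmoothFieldAt (V : ∀ y : N, TangentSpace I y) (x : N) : Prop :=
  ContMDiffAt I I.tangent ∞ (fun y => (⟨y, V y⟩ : TangentBundle I N)) x

theorem covariantDerivative_sum_smul (D : CovariantDerivative I E (TangentSpace I : N → Type _))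
    {ι : Type*} (s : Finset ι) {f : ι → N → ℝ} {V : ι → ∀ y : N, TangentSpace I y} {x : N}
    (hf : ∀ i, MDifferentiableAt I 𝓘(ℝ, ℝ) (f i) x) (hV : ∀ i, DiffFieldAt I (V i) x)
    (X : TangentSpace I x) :
    D (fun y => ∑ i ∈ s, f i y • V i y) x X
      = ∑ i ∈ s, (f i x • D (V i) x X + mvfderiv I (f i) x X • V i x) := by
  classical
  induction s using Finset.induction_on with
  | empty =>
    have h : (fun y : N => ∑ i ∈ (∅ : Finset ι), f i y • V i y)
      = (0 : ∀ y : N, TangentSpace I y) := by ext; simp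
    rw [h, D.zero]
    simp
  | insert i s hi ih =>
    have h1 : DiffFieldAt I (f i • V i) x := (hf i).smul_section (hV i)
    have h2 : DiffFieldAt I (fun y => ∑ i ∈ s, f i y • V i y) x :=
      MDifferentiableAt.sum_section fun i _ => (hf i).smul_section (hV i)
    have h : (fun y : N => ∑ i ∈ insert i s, f i y • V i y)
        = (f i • V i) + (fun y => ∑ i ∈ s, f i y • V i y) := by
      funext y
      simp [Finset.sum_insert hi]
    rw [h, D.isCovariantDerivativeOn.add (s := univ) h1 h2,
      D.isCovariantDerivativeOn.leibniz (s := univ) (hV i) (hf i), Finset.sum_insert hi, ← ih]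
    simp

theorem covariantDerivative_congr (D : CovariantDerivative I E (TangentSpace I : N → Type _))
    {V W : ∀ y : N, TangentSpace I y} {x : N} (hV : DiffFieldAt I V x)
    (h : ∀ᶠ y in nhds x, V y = W y) : D V x = D W x := by
  have hW : DiffFieldAt I W x := hV.congr_of_eventuallyEq (by
    filter_upwards [h] with y hy
    rw [hy])
  exact D.isCovariantDerivativeOn.congr_of_eventuallyEq (s := univ) hV hW Filter.univ_mem h

variable [FiniteDimensional ℝ E] [CompleteSpace E]

theorem IsLeviCivita.sub_eq_mlieBracket {G : ∀ x : N, TangentSpace I x → TangentSpace I x → ℝ}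
    {D : CovariantDerivative I E (TangentSpace I : N → Type _)} (hD : IsLeviCivita G D) {x : N}
    {X Y : ∀ y : N, TangentSpace I y} (hX : DiffFieldAt I X x) (hY : DiffFieldAt I Y x) :
    D Y x (X x) - D X x (Y x) = VectorField.mlieBracket I X Y x :=
  D.torsion_eq_zero_iff.1 hD.torsion hX hY

/-- The Koszul formula. Neither positivity nor smoothness of `G` is needed. -/
theorem IsLeviCivita.koszul {G : ∀ x : N, TangentSpace I x → TangentSpace I x → ℝ}
    {D : CovariantDerivative I E (TangentSpace I : N → Type _)} (hD : IsLeviCivita G D)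
    {x : N} (hsymm : ∀ X Y, G x X Y = G x Y X)
    (hsub : ∀ X Y Z, G x (X - Y) Z = G x X Z - G x Y Z)
    {X Y Z : ∀ y : N, TangentSpace I y} (hX : DiffFieldAt I X x) (hY : DiffFieldAt I Y x)
    (hZ : DiffFieldAt I Z x) :
    2 * G x (D Y x (X x)) (Z x)
      = mvfderiv I (fun y => G y (Y y) (Z y)) x (X x)
        + mvfderiv I (fun y => G y (X y) (Z y)) x (Y x)
        - mvfderiv I (fun y => G y (X y) (Y y)) x (Z x)
        + G x (VectorField.mlieBracket I X Y x) (Z x)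
        - G x (VectorField.mlieBracket I X Z x) (Y x)
        - G x (VectorField.mlieBracket I Y Z x) (X x) := by
  rw [hD.metric x (X x) Y Z hY hZ, hD.metric x (Y x) X Z hX hZ, hD.metric x (Z x) X Y hX hY,
    ← hD.sub_eq_mlieBracket hX hY, ← hD.sub_eq_mlieBracket hX hZ, ← hD.sub_eq_mlieBracket hY hZ,
    hsub, hsub, hsub, hsymm (Y x), hsymm (X x) (D Z x (Y x)), hsymm (X x) (D Y x (Z x))]
  ring

end Connections

/-! ### Directional derivatives -/

section DirectionalDerivative

variable {E : Type*} [NormedAddCommGroup E] [NormedSpace ℝ E]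
  {H : Type*} [TopologicalSpace H] {I : ModelWithCorners ℝ E H}
  {N : Type*} [TopologicalSpace N] [ChartedSpace H N] {x : N} {ξ : TangentSpace I x}

variable (I) in
/-- The function `f` is differentiable at `x` and its derivative in the direction `ξ` is `a`. -/
def HasDirDeriv (x : N) (ξ : TangentSpace I x) (f : N → ℝ) (a : ℝ) : Prop :=
  MDifferentiableAt I 𝓘(ℝ, ℝ) f x ∧ mvfderiv I f x ξ = a

namespace HasDirDeriv

variable {f f' : N → ℝ} {a a' : ℝ}

theorem const (r : ℝ) : HasDirDeriv I x ξ (fun _ => r) 0 :=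
  ⟨mdifferentiableAt_const, by rw [mvfderiv_const]; rfl⟩

theorem add (h : HasDirDeriv I x ξ f a) (h' : HasDirDeriv I x ξ f' a') :
    HasDirDeriv I x ξ (fun y => f y + f' y) (a + a') :=
  ⟨h.1.add h'.1, by rw [mvfderiv_fun_add h.1 h'.1, ← h.2, ← h'.2]; rfl⟩

theorem mul (h : HasDirDeriv I x ξ f a) (h' : HasDirDeriv I x ξ f' a') :
    HasDirDeriv I x ξ (fun y => f y * f' y) (a * f' x + f x * a') :=
  ⟨h.1.mul h'.1, by
    rw [mvfderiv_fun_mul h.1 h'.1, ← h.2, ← h'.2]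
    simp
    ring⟩

theorem sum {ι : Type*} {s : Finset ι} {f : ι → N → ℝ} {a : ι → ℝ}
    (h : ∀ i ∈ s, HasDirDeriv I x ξ (f i) (a i)) :
    HasDirDeriv I x ξ (fun y => ∑ i ∈ s, f i y) (∑ i ∈ s, a i) := by
  classical
  induction s using Finset.induction_on with
  | empty => simpa using const 0
  | insert i s hi ih =>
    simp only [Finset.sum_insert hi]
    exact (h i (by simp)).add (ih fun j hj => h j (by simp [hj]))

theorem congr (h : HasDirDeriv I x ξ f a) (hf : f' =ᶠ[nhds x] f) (ha : a = a') :
    HasDirDeriv I x ξ f' a' :=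
  ⟨h.1.congr_of_eventuallyEq hf, by rw [mvfderiv_congr hf, h.2, ha]⟩

/-- The chain rule for an outer function which is only differentiable within a set containing the
range of the inner one. -/
theorem comp_of_hasDerivWithinAt {c : ℝ → ℝ} {c' : ℝ} {s : Set ℝ} (h : HasDirDeriv I x ξ f a)
    (hc : HasDerivWithinAt c c' s (f x)) (hs : ∀ y, f y ∈ s) :
    HasDirDeriv I x ξ (fun y => c (f y)) (c' * a) := by
  have h1 : HasMFDerivWithinAt 𝓘(ℝ, ℝ) 𝓘(ℝ, ℝ) c s (f x) _ :=
    hc.hasFDerivWithinAt.hasMFDerivWithinAt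
  have h2 := HasMFDerivWithinAt.comp x h1 (hasMFDerivWithinAt_univ.2 h.1.hasMFDerivAt)
    (fun y _ => hs y)
  rw [hasMFDerivWithinAt_univ] at h2
  refine ⟨h2.mdifferentiableAt, ?_⟩
  have e : mvfderiv I (c ∘ f) x ξ = mfderiv I 𝓘(ℝ, ℝ) (c ∘ f) x ξ := rfl
  rw [← h.2]
  refine e.trans ?_
  rw [h2.mfderiv, mul_comm]
  rfl

end HasDirDeriv

end DirectionalDerivative

/-! ### Coordinate fields on the base -/

theorem isInvertible_mfderiv_of_local_inverse {E E' H H' N N' : Type*}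
    [NormedAddCommGroup E] [NormedSpace ℝ E] [NormedAddCommGroup E'] [NormedSpace ℝ E']
    [TopologicalSpace H] [TopologicalSpace H'] {I : ModelWithCorners ℝ E H}
    {I' : ModelWithCorners ℝ E' H'} [TopologicalSpace N] [ChartedSpace H N]
    [TopologicalSpace N'] [ChartedSpace H' N'] {f : N → N'} {g : N' → N} {x : N}
    (hf : MDifferentiableAt I I' f x) (hg : MDifferentiableAt I' I g (f x))
    (hgf : ∀ᶠ y in nhds x, g (f y) = y) (hfg : ∀ᶠ z in nhds (f x), f (g z) = z) :
    (mfderiv I I' f x).IsInvertible := by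
  have h1 := mfderiv_comp x hg hf
  have hf' : HasMFDerivAt I I' f (g (f x)) (mfderiv I I' f x : E →L[ℝ] E') := by
    rw [hgf.self_of_nhds]
    exact hf.hasMFDerivAt
  have h2 := (hf'.comp (f x) hg.hasMFDerivAt).mfderiv
  have h3 : g ∘ f =ᶠ[nhds x] id := hgf
  have h4 : f ∘ g =ᶠ[nhds (f x)] id := hfg
  have h5 : mfderiv I I (g ∘ f) x = ContinuousLinearMap.id ℝ E := by
    rw [h3.mfderiv_eq, mfderiv_id]; rfl
  have h6 : mfderiv I' I' (f ∘ g) (f x) = ContinuousLinearMap.id ℝ E' := by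
    rw [h4.mfderiv_eq, mfderiv_id]; rfl
  exact ContinuousLinearMap.IsInvertible.of_inverse (g := (mfderiv I' I g (f x) : E' →L[ℝ] E))
    (h2.symm.trans h6) (h1.symm.trans h5)

variable {n : ℕ} {M : Type*} [TopologicalSpace M] [ChartedSpace (Coord n) M]
  [IsManifold (𝓡 n) ∞ M]

section Base

variable {e : Chart n M} {x : M}

theorem contMDiffAt_chart (he : e ∈ IsManifold.maximalAtlas (𝓡 n) ∞ M) (hx : x ∈ e.source) :
    ContMDiffAt (𝓡 n) 𝓘(ℝ, Coord n) ∞ e x :=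
  (contMDiffOn_of_mem_maximalAtlas he).contMDiffAt (e.open_source.mem_nhds hx)

theorem contMDiffAt_chart_symm (he : e ∈ IsManifold.maximalAtlas (𝓡 n) ∞ M) {z : Coord n}
    (hz : z ∈ e.target) : ContMDiffAt 𝓘(ℝ, Coord n) (𝓡 n) ∞ e.symm z :=
  (contMDiffOn_symm_of_mem_maximalAtlas he).contMDiffAt (e.open_target.mem_nhds hz)

theorem isInvertible_mfderiv_chart (he : e ∈ IsManifold.maximalAtlas (𝓡 n) ∞ M)
    (hx : x ∈ e.source) : (mfderiv (𝓡 n) 𝓘(ℝ, Coord n) e x).IsInvertible :=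
  isInvertible_mfderiv_of_local_inverse
    ((contMDiffAt_chart he hx).mdifferentiableAt (by simp))
    ((contMDiffAt_chart_symm he (e.map_source hx)).mdifferentiableAt (by simp))
    (e.eventually_left_inverse hx) (e.eventually_right_inverse (e.map_source hx))

theorem smoothFieldAt_mpullback_const {E E' H N : Type*}
    [NormedAddCommGroup E] [NormedSpace ℝ E] [CompleteSpace E] [NormedAddCommGroup E']
    [NormedSpace ℝ E'] [CompleteSpace E']
    [TopologicalSpace H] {I : ModelWithCorners ℝ E H} [TopologicalSpace N] [ChartedSpace H N]
    [IsManifold I ∞ N] {f : N → E'} {x : N}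
    (hf : ContMDiffAt I 𝓘(ℝ, E') ∞ f x) (hf' : (mfderiv I 𝓘(ℝ, E') f x).IsInvertible) (v : E') :
    ContMDiffAt I I.tangent ∞ (fun y =>
      (⟨y, VectorField.mpullback I 𝓘(ℝ, E') f (fun _ => v) y⟩ : TangentBundle I N)) x := by
  refine ContMDiffAt.mpullback_vectorField_preimage (V := fun _ => v) ?_ hf hf' (by simp)
  exact contMDiffAt_vectorSpace_iff_contDiffAt.2 contDiffAt_const

theorem smoothFieldAt_baseFrame (he : e ∈ IsManifold.maximalAtlas (𝓡 n) ∞ M)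
    (hx : x ∈ e.source) (i : Fin n) : SmoothFieldAt (𝓡 n) (baseFrame e i) x :=
  smoothFieldAt_mpullback_const (contMDiffAt_chart he hx) (isInvertible_mfderiv_chart he hx) _

theorem diffFieldAt_baseFrame (he : e ∈ IsManifold.maximalAtlas (𝓡 n) ∞ M)
    (hx : x ∈ e.source) (i : Fin n) : DiffFieldAt (𝓡 n) (baseFrame e i) x :=
  (smoothFieldAt_baseFrame he hx i).mdifferentiableAt (by simp)

theorem mvfderiv_chart_baseFrame (he : e ∈ IsManifold.maximalAtlas (𝓡 n) ∞ M)
    (hx : x ∈ e.source) (i : Fin n) :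
    mvfderiv (𝓡 n) e x (baseFrame e i x) = EuclideanSpace.single i 1 :=
  (isInvertible_mfderiv_chart he hx).self_apply_inverse _

theorem mvfderiv_chart_injective (he : e ∈ IsManifold.maximalAtlas (𝓡 n) ∞ M)
    (hx : x ∈ e.source) : Function.Injective (mvfderiv (𝓡 n) e x) := fun X Y h => by
  have h' : mfderiv (𝓡 n) 𝓘(ℝ, Coord n) e x X = mfderiv (𝓡 n) 𝓘(ℝ, Coord n) e x Y := h
  have := congrArg (mfderiv (𝓡 n) 𝓘(ℝ, Coord n) e x).inverse h'
  rwa [(isInvertible_mfderiv_chart he hx).inverse_apply_self,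
    (isInvertible_mfderiv_chart he hx).inverse_apply_self] at this

theorem baseCoframe_baseFrame (he : e ∈ IsManifold.maximalAtlas (𝓡 n) ∞ M)
    (hx : x ∈ e.source) (i j : Fin n) :
    baseCoframe e i x (baseFrame e j x) = if i = j then 1 else 0 := by
  simp [baseCoframe, mvfderiv_chart_baseFrame he hx]

theorem sum_baseCoframe_smul (he : e ∈ IsManifold.maximalAtlas (𝓡 n) ∞ M)
    (hx : x ∈ e.source) (X : TangentSpace (𝓡 n) x) :
    ∑ i, baseCoframe e i x X • baseFrame e i x = X := by
  apply mvfderiv_chart_injective he hx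
  rw [map_sum]
  simp_rw [map_smul, mvfderiv_chart_baseFrame he hx]
  ext j
  simp [baseCoframe, Pi.single_apply]

/-- The coordinate differential `dxⁱ` as a covector. It is defined through the `i`-th component of the
chart, so that it is visibly a smooth field; its values are `baseCoframe`. -/
def coordCovector (e : Chart n M) (i : Fin n) (x : M) : TangentSpace (𝓡 n) x →L[ℝ] ℝ :=
  mvfderiv (𝓡 n) (fun y => e y i) x

theorem contMDiffAt_chart_apply (he : e ∈ IsManifold.maximalAtlas (𝓡 n) ∞ M)
    (hx : x ∈ e.source) (i : Fin n) : ContMDiffAt (𝓡 n) 𝓘(ℝ, ℝ) ∞ (fun y => e y i) x :=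
  ((EuclideanSpace.proj (𝕜 := ℝ) i : Coord n →L[ℝ] ℝ).contMDiff.contMDiffAt).comp x
    (contMDiffAt_chart he hx)

theorem coordCovector_apply (he : e ∈ IsManifold.maximalAtlas (𝓡 n) ∞ M)
    (hx : x ∈ e.source) (i : Fin n) (X : TangentSpace (𝓡 n) x) :
    coordCovector e i x X = baseCoframe e i x X := by
  have := mvfderiv_comp_apply x
    (g := (EuclideanSpace.proj (𝕜 := ℝ) i : Coord n →L[ℝ] ℝ)) (f := e)
    (ContinuousLinearMap.mdifferentiableAt _)
    ((contMDiffAt_chart he hx).mdifferentiableAt (by simp)) X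
  rw [mvfderiv_eq_fderiv, ContinuousLinearMap.fderiv] at this
  exact this

theorem mlieBracket_baseFrame (he : e ∈ IsManifold.maximalAtlas (𝓡 n) ∞ M)
    (hx : x ∈ e.source) (i j : Fin n) :
    VectorField.mlieBracket (𝓡 n) (baseFrame e i) (baseFrame e j) x = 0 := by
  have key : ∀ k, baseCoframe e k x
      (VectorField.mlieBracket (𝓡 n) (baseFrame e i) (baseFrame e j) x) = 0 := by
    intro k
    have hc : ∀ l, (fun y => mvfderiv (𝓡 n) (fun y => e y k) y (baseFrame e l y)) =ᶠ[nhds x]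
        fun _ => if k = l then 1 else 0 := by
      intro l
      filter_upwards [e.open_source.mem_nhds hx] with y hy
      rw [← baseCoframe_baseFrame he hy, ← coordCovector_apply he hy]
      rfl
    rw [← coordCovector_apply he hx, coordCovector,
      mvfderiv_mlieBracket (contMDiffAt_chart_apply he hx k) (diffFieldAt_baseFrame he hx i)
        (diffFieldAt_baseFrame he hx j), mvfderiv_congr (hc i), mvfderiv_congr (hc j),
      mvfderiv_const, mvfderiv_const]
    simp
  rw [← sum_baseCoframe_smul he hx (VectorField.mlieBracket (𝓡 n) _ _ x)]
  simp [key]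

end Base

/-! ### The induced chart of the cotangent bundle -/

section Induced

variable {e : Chart n M} {p : Cotangent n M}

theorem contMDiffAt_cotangent_proj (p : Cotangent n M) :
    ContMDiffAt (cotModel n) (𝓡 n) ∞ (fun q : Cotangent n M => q.proj) p :=
  (contMDiff_proj (n := ∞) (IB := 𝓡 n) (F := Coord n →L[ℝ] ℝ)
    (fun x : M => TangentSpace (𝓡 n) x →L[ℝ] ℝ)).contMDiffAt

theorem contMDiffAt_evalField {Y : ∀ x : M, TangentSpace (𝓡 n) x}
    (hY : SmoothFieldAt (𝓡 n) Y p.proj) :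
    ContMDiffAt (cotModel n) 𝓘(ℝ, ℝ) ∞ (evalField Y) p := by
  have h1 : ContMDiffAt (cotModel n) ((𝓡 n).prod 𝓘(ℝ, Coord n →L[ℝ] ℝ)) ∞
      (fun q : Cotangent n M => TotalSpace.mk' (Coord n →L[ℝ] ℝ)
        (E := fun x : M => TangentSpace (𝓡 n) x →L[ℝ] Bundle.Trivial M ℝ x) q.proj q.2) p :=
    contMDiffAt_id (I := cotModel n) (x := p)
  have h2 : ContMDiffAt (cotModel n) ((𝓡 n).prod 𝓘(ℝ, Coord n)) ∞
      (fun q : Cotangent n M => TotalSpace.mk' (Coord n)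
        (E := fun x : M => TangentSpace (𝓡 n) x) q.proj (Y q.proj)) p :=
    hY.comp p (contMDiffAt_cotangent_proj p)
  have h3 := ContMDiffAt.clm_bundle_apply (E₂ := Bundle.Trivial M ℝ)
    (b := fun q : Cotangent n M => q.proj) (ϕ := fun q => q.2) h1 h2
  rw [contMDiffAt_totalSpace] at h3
  exact h3.2

theorem contMDiffAt_fibreCoord (he : e ∈ IsManifold.maximalAtlas (𝓡 n) ∞ M)
    (hp : p.proj ∈ e.source) (i : Fin n) :
    ContMDiffAt (cotModel n) 𝓘(ℝ, ℝ) ∞ (fibreCoord e i) p :=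
  contMDiffAt_evalField (smoothFieldAt_baseFrame he hp i)

theorem eventually_proj_mem (e : Chart n M) (hp : p.proj ∈ e.source) :
    ∀ᶠ q : Cotangent n M in nhds p, q.proj ∈ e.source :=
  (contMDiffAt_cotangent_proj p).continuousAt.eventually (e.open_source.mem_nhds hp)

/-- The induced chart is smooth for the bundle structure of `T*M`, which is given by trivializations
coming from the preferred atlas only. -/
theorem contMDiffAt_inducedChart (he : e ∈ IsManifold.maximalAtlas (𝓡 n) ∞ M)
    (hp : p.proj ∈ e.source) :
    ContMDiffAt (cotModel n) 𝓘(ℝ, Coord n × Coord n) ∞ (inducedChart e) p := by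
  refine ContMDiffAt.prodMk_space ((contMDiffAt_chart he hp).comp p (contMDiffAt_cotangent_proj p))
    ?_
  have h : ContMDiffAt (cotModel n) 𝓘(ℝ, Fin n → ℝ) ∞
      (fun q : Cotangent n M => fun i => fibreCoord e i q) p :=
    contMDiffAt_pi_space.2 fun i => contMDiffAt_fibreCoord he hp i
  exact (((PiLp.continuousLinearEquiv 2 ℝ (fun _ : Fin n => ℝ)).symm :
    (Fin n → ℝ) →L[ℝ] Coord n).contMDiff.contMDiffAt).comp p h

/-- The inverse of the induced chart: `(x, a) ↦ Σ aᵢ dxⁱ`. -/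
def inducedChartSymm (e : Chart n M) (z : Coord n × Coord n) : Cotangent n M :=
  ⟨e.symm z.1, ∑ i, z.2 i • coordCovector e i (e.symm z.1)⟩

theorem covector_eq_sum (he : e ∈ IsManifold.maximalAtlas (𝓡 n) ∞ M) {x : M} (hx : x ∈ e.source)
    (θ : TangentSpace (𝓡 n) x →L[ℝ] ℝ) :
    ∑ i, θ (baseFrame e i x) • coordCovector e i x = θ := by
  ext X
  conv_rhs => rw [← sum_baseCoframe_smul he hx X, map_sum]
  rw [_root_.sum_apply]
  refine Finset.sum_congr rfl fun i _ => ?_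
  rw [map_smul, _root_.smul_apply, coordCovector_apply he hx, smul_eq_mul, smul_eq_mul,
    mul_comm]

theorem inducedChartSymm_inducedChart (he : e ∈ IsManifold.maximalAtlas (𝓡 n) ∞ M)
    (hp : p.proj ∈ e.source) : inducedChartSymm e (inducedChart e p) = p := by
  obtain ⟨x, θ⟩ := p
  have h : e.symm (e x) = x := e.left_inv hp
  unfold inducedChartSymm
  simp only [inducedChart]
  rw [h]
  congr 1
  exact covector_eq_sum he hp θ

theorem inducedChart_inducedChartSymm (he : e ∈ IsManifold.maximalAtlas (𝓡 n) ∞ M)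
    {z : Coord n × Coord n} (hz : z.1 ∈ e.target) :
    inducedChart e (inducedChartSymm e z) = z := by
  have hx := e.map_target hz
  refine Prod.ext (e.right_inv hz) ?_
  ext j
  have : fibreCoord e j (inducedChartSymm e z)
    = (∑ i, z.2 i • coordCovector e i (e.symm z.1)) (baseFrame e j (e.symm z.1)) := rfl
  simp only [inducedChart, this, _root_.sum_apply, _root_.smul_apply,
    coordCovector_apply he hx, baseCoframe_baseFrame he hx]
  simp

/-- Differentiability is tested in a trivialization of `T*M`, which is linear in the fibres. -/
theorem mdifferentiableAt_inducedChartSymm (he : e ∈ IsManifold.maximalAtlas (𝓡 n) ∞ M)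
    {z : Coord n × Coord n} (hz : z.1 ∈ e.target) :
    MDifferentiableAt 𝓘(ℝ, Coord n × Coord n) (cotModel n) (inducedChartSymm e) z := by
  have hx := e.map_target hz
  have hs : MDifferentiableAt 𝓘(ℝ, Coord n × Coord n) (𝓡 n)
      (fun z : Coord n × Coord n => e.symm z.1) z :=
    MDifferentiableAt.comp z (I' := 𝓘(ℝ, Coord n))
      ((contMDiffAt_chart_symm he hz).mdifferentiableAt (by simp))
      (differentiableAt_fst.mdifferentiableAt)
  rw [mdifferentiableAt_totalSpace]
  refine ⟨hs, ?_⟩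
  set t := trivializationAt (Coord n →L[ℝ] ℝ) (fun x : M => TangentSpace (𝓡 n) x →L[ℝ] ℝ)
    (inducedChartSymm e z).proj with ht
  have hi : ∀ i, MDifferentiableAt 𝓘(ℝ, Coord n × Coord n) 𝓘(ℝ, Coord n →L[ℝ] ℝ)
      (fun z : Coord n × Coord n =>
        (t ⟨e.symm z.1, coordCovector e i (e.symm z.1)⟩).2) z := by
    intro i
    have h1 := (contMDiffAt_mvfderiv (contMDiffAt_chart_apply he hx i)).mdifferentiableAt
      (by simp)
    rw [mdifferentiableAt_totalSpace] at h1
    exact MDifferentiableAt.comp z (I' := 𝓡 n) (g := fun y : M => (t ⟨y, coordCovector e i y⟩).2)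
      h1.2 hs
  have hsum : MDifferentiableAt 𝓘(ℝ, Coord n × Coord n) 𝓘(ℝ, Coord n →L[ℝ] ℝ)
      (fun z : Coord n × Coord n => ∑ i, z.2 i •
        (t ⟨e.symm z.1, coordCovector e i (e.symm z.1)⟩).2) z := by
    rw [mdifferentiableAt_iff_differentiableAt]
    refine DifferentiableAt.fun_sum fun i _ => DifferentiableAt.fun_smul ?_
      (mdifferentiableAt_iff_differentiableAt.1 (hi i))
    exact ((EuclideanSpace.proj (𝕜 := ℝ) i : Coord n →L[ℝ] ℝ).comp
      (ContinuousLinearMap.snd ℝ (Coord n) (Coord n))).differentiableAt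
  refine hsum.congr_of_eventuallyEq ?_
  have hb : ∀ᶠ z' in nhds z, e.symm z'.1 ∈ t.baseSet :=
    hs.continuousAt.eventually (t.open_baseSet.mem_nhds
      (FiberBundle.mem_baseSet_trivializationAt' _))
  filter_upwards [hb] with z' hz'
  have hl := t.linear ℝ hz'
  have := map_sum (IsLinearMap.mk' _ hl)
    (fun i => z'.2 i • coordCovector e i (e.symm z'.1)) Finset.univ
  refine this.trans (Finset.sum_congr rfl fun i _ => ?_)
  exact map_smul (IsLinearMap.mk' _ hl) _ _

theorem isInvertible_mfderiv_inducedChart (he : e ∈ IsManifold.maximalAtlas (𝓡 n) ∞ M)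
    (hp : p.proj ∈ e.source) :
    (mfderiv (cotModel n) 𝓘(ℝ, Coord n × Coord n) (inducedChart e) p).IsInvertible := by
  have hz : (inducedChart e p).1 ∈ e.target := e.map_source hp
  refine isInvertible_mfderiv_of_local_inverse (g := inducedChartSymm e)
    ((contMDiffAt_inducedChart he hp).mdifferentiableAt (by simp))
    (mdifferentiableAt_inducedChartSymm he hz) ?_ ?_
  · filter_upwards [eventually_proj_mem e hp] with q hq
    exact inducedChartSymm_inducedChart he hq
  · filter_upwards [continuous_fst.continuousAt.eventually (e.open_target.mem_nhds hz)] with z hz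
    exact inducedChart_inducedChartSymm he hz

end Induced

/-! ### Inverse matrices -/

section MatrixInverse

variable {ι F : Type*} [Fintype ι] [DecidableEq ι] [NormedAddCommGroup F] [NormedSpace ℝ F]

theorem contDiffAt_matrix_det {A : F → Matrix ι ι ℝ} {x : F}
    (hA : ∀ i j, ContDiffAt ℝ ∞ (fun y => A y i j) x) :
    ContDiffAt ℝ ∞ (fun y => (A y).det) x := by
  simp only [Matrix.det_apply']
  exact ContDiffAt.sum fun σ _ => contDiffAt_const.mul (contDiffAt_prod fun i _ => hA _ _)

theorem contDiffAt_matrix_inv_apply {A : F → Matrix ι ι ℝ} {x : F}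
    (hA : ∀ i j, ContDiffAt ℝ ∞ (fun y => A y i j) x) (hx : (A x).det ≠ 0) (i j : ι) :
    ContDiffAt ℝ ∞ (fun y => (A y)⁻¹ i j) x := by
  -- Cramer's rule
  have h : ∀ y, (A y)⁻¹ i j = (A y).det⁻¹ * ((A y).updateRow j (Pi.single i 1)).det := by
    intro y
    rw [Matrix.inv_def, Ring.inverse_eq_inv', Matrix.smul_apply, Matrix.adjugate_apply, smul_eq_mul]
  simp only [h]
  refine ((contDiffAt_matrix_det hA).inv hx).mul (contDiffAt_matrix_det fun k l => ?_)
  by_cases hk : k = j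
  · subst hk
    simp only [Matrix.updateRow_self]
    exact contDiffAt_const
  · simp only [Matrix.updateRow_ne hk]
    exact hA k l

end MatrixInverse

theorem isInvertible_of_bijective {E F : Type*} [NormedAddCommGroup E] [NormedSpace ℝ E]
    [FiniteDimensional ℝ E] [NormedAddCommGroup F] [NormedSpace ℝ F] (f : E →L[ℝ] F)
    (hf : Function.Bijective f) : f.IsInvertible :=
  ⟨(LinearEquiv.ofBijective (f : E →ₗ[ℝ] F) hf).toContinuousLinearEquiv, by ext; rfl⟩

/-! ### The Riemannian metric of the base in a chart -/

section BaseMetricChart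

variable {e : Chart n M} {x : M} (g : BaseMetric n M)

theorem contMDiffAt_gMat (he : e ∈ IsManifold.maximalAtlas (𝓡 n) ∞ M) (hx : x ∈ e.source)
    (i j : Fin n) : ContMDiffAt (𝓡 n) 𝓘(ℝ, ℝ) ∞ (fun y => gMat g e y i j) x := by
  have h3 := ContMDiffAt.clm_bundle_apply₂ (E₃ := Bundle.Trivial M ℝ)
    (b := fun y : M => y) (ψ := fun y => g.inner y) g.contMDiff.contMDiffAt
    (smoothFieldAt_baseFrame he hx i) (smoothFieldAt_baseFrame he hx j)
  rw [contMDiffAt_totalSpace] at h3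
  exact h3.2

theorem gMat_symm (i j : Fin n) : gMat g e x i j = gMat g e x j i := g.symm _ _ _

theorem inner_sum_smul_baseFrame (v w : Fin n → ℝ) :
    g.inner x (∑ i, v i • baseFrame e i x) (∑ j, w j • baseFrame e j x)
      = ∑ i, ∑ j, v i * gMat g e x i j * w j := by
  simp only [map_sum, map_smul, _root_.sum_apply, _root_.smul_apply, smul_eq_mul, gMat,
    Matrix.of_apply, Finset.mul_sum]
  rw [Finset.sum_comm]
  exact Finset.sum_congr rfl fun i _ => Finset.sum_congr rfl fun j _ => by ring

theorem det_gMat_ne_zero (he : e ∈ IsManifold.maximalAtlas (𝓡 n) ∞ M) (hx : x ∈ e.source) :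
    (gMat g e x).det ≠ 0 := by
  intro h
  obtain ⟨v, hv, h0⟩ := Matrix.exists_mulVec_eq_zero_iff.2 h
  have h1 : g.inner x (∑ i, v i • baseFrame e i x) (∑ j, v j • baseFrame e j x) = 0 := by
    rw [inner_sum_smul_baseFrame]
    refine Finset.sum_eq_zero fun i _ => ?_
    have := congrFun h0 i
    simp only [Matrix.mulVec, dotProduct, Pi.zero_apply] at this
    simp only [mul_assoc, ← Finset.mul_sum, this, mul_zero]
  have h2 : ∑ i, v i • baseFrame e i x = 0 := by
    by_contra hne
    exact (g.pos x _ hne).ne' h1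
  apply hv
  funext k
  have := congrArg (coordCovector e k x) h2
  rw [map_sum, map_zero] at this
  simp only [map_smul] at this
  simp only [coordCovector_apply he hx, baseCoframe_baseFrame he hx] at this
  simpa using this

theorem contMDiffAt_gInv (he : e ∈ IsManifold.maximalAtlas (𝓡 n) ∞ M) (hx : x ∈ e.source)
    (i j : Fin n) : ContMDiffAt (𝓡 n) 𝓘(ℝ, ℝ) ∞ (fun y => gInv g e y i j) x := by
  have h1 : ContMDiffAt (𝓡 n) 𝓘(ℝ, Fin n → Fin n → ℝ) ∞ (fun y => fun i j => gMat g e y i j) x :=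
    contMDiffAt_pi_space.2 fun i => contMDiffAt_pi_space.2 fun j => contMDiffAt_gMat g he hx i j
  have h2 : ContDiffAt ℝ ∞ (fun A : Fin n → Fin n → ℝ => (Matrix.of A)⁻¹ i j)
      (fun i j => gMat g e x i j) :=
    contDiffAt_matrix_inv_apply (A := fun A : Fin n → Fin n → ℝ => Matrix.of A)
      (fun i j => contDiffAt_pi.1 (contDiffAt_pi.1 contDiffAt_id i) j) (det_gMat_ne_zero g he hx) i j
  exact h2.contMDiffAt.comp x h1

theorem gInv_symm (i j : Fin n) : gInv g e x i j = gInv g e x j i := by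
  have h : (gMat g e x).transpose = gMat g e x := by ext i j; exact gMat_symm g j i
  have h2 : (gInv g e x).transpose = gInv g e x := by
    rw [gInv, Matrix.transpose_nonsing_inv, h]
  exact congrFun (congrFun h2 j) i

theorem sum_gInv_mul_gMat (he : e ∈ IsManifold.maximalAtlas (𝓡 n) ∞ M) (hx : x ∈ e.source)
    (i j : Fin n) : ∑ k, gInv g e x i k * gMat g e x k j = if i = j then 1 else 0 := by
  have := Matrix.nonsing_inv_mul (gMat g e x) (det_gMat_ne_zero g he hx).isUnit
  have := congrFun (congrFun this i) j
  rwa [Matrix.mul_apply, Matrix.one_apply] at this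

theorem sum_gMat_mul_gInv (he : e ∈ IsManifold.maximalAtlas (𝓡 n) ∞ M) (hx : x ∈ e.source)
    (i j : Fin n) : ∑ k, gMat g e x i k * gInv g e x k j = if i = j then 1 else 0 := by
  have := Matrix.mul_nonsing_inv (gMat g e x) (det_gMat_ne_zero g he hx).isUnit
  have := congrFun (congrFun this i) j
  rwa [Matrix.mul_apply, Matrix.one_apply] at this

theorem inner_sum_gInv_smul (he : e ∈ IsManifold.maximalAtlas (𝓡 n) ∞ M) (hx : x ∈ e.source)
    (θ : TangentSpace (𝓡 n) x →L[ℝ] ℝ) :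
    g.inner x (∑ i, (∑ j, gInv g e x i j * θ (baseFrame e j x)) • baseFrame e i x) = θ := by
  have hk : ∀ k, g.inner x
      (∑ i, (∑ j, gInv g e x i j * θ (baseFrame e j x)) • baseFrame e i x) (baseFrame e k x)
      = θ (baseFrame e k x) := by
    intro k
    have hg : ∀ i, g.inner x (baseFrame e i x) (baseFrame e k x) = gMat g e x k i :=
      fun i => gMat_symm g i k
    simp only [map_sum, map_smul, _root_.sum_apply, _root_.smul_apply, smul_eq_mul, hg,
      Finset.sum_mul]
    rw [Finset.sum_comm]
    have : ∀ j, ∑ i, gInv g e x i j * θ (baseFrame e j x) * gMat g e x k i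
        = (if k = j then 1 else 0) * θ (baseFrame e j x) := by
      intro j
      rw [← sum_gMat_mul_gInv g he hx, Finset.sum_mul]
      exact Finset.sum_congr rfl fun i _ => by ring
    simp [this]
  rw [← covector_eq_sum he hx θ, ← covector_eq_sum he hx (g.inner x _)]
  simp only [hk, covector_eq_sum he hx]

theorem sharp_eq_sum (he : e ∈ IsManifold.maximalAtlas (𝓡 n) ∞ M) (hx : x ∈ e.source)
    (θ : TangentSpace (𝓡 n) x →L[ℝ] ℝ) :
    sharp g x θ = ∑ i, (∑ j, gInv g e x i j * θ (baseFrame e j x)) • baseFrame e i x := by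
  have hinj : Function.Injective (g.inner x) := by
    intro X Y h
    by_contra hne
    have h1 := g.pos x (X - Y) (sub_ne_zero.2 hne)
    have h2 : g.inner x (X - Y) = 0 := by rw [map_sub, h, sub_self]
    rw [h2] at h1
    exact lt_irrefl _ h1
  have hinv : (g.inner x).IsInvertible :=
    isInvertible_of_bijective (E := Coord n) (F := Coord n →L[ℝ] ℝ) (g.inner x)
      ⟨hinj, fun θ => ⟨_, inner_sum_gInv_smul g he hx θ⟩⟩
  conv_lhs => rw [sharp, ← inner_sum_gInv_smul g he hx θ, hinv.inverse_apply_self]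

theorem inner_sharp (x : M) (θ : TangentSpace (𝓡 n) x →L[ℝ] ℝ) : g.inner x (sharp g x θ) = θ := by
  have he := IsManifold.chart_mem_maximalAtlas (I := 𝓡 n) (n := ∞) x
  have hx := mem_chart_source (Coord n) x
  rw [sharp_eq_sum g he hx, inner_sum_gInv_smul g he hx]

theorem coInner_self_nonneg (x : M) (θ : TangentSpace (𝓡 n) x →L[ℝ] ℝ) : 0 ≤ coInner g x θ θ := by
  have h1 : coInner g x θ θ = g.inner x (sharp g x θ) (sharp g x θ) := by
    rw [inner_sharp, coInner]
  rw [h1]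
  by_cases h : sharp g x θ = 0
  · rw [h, map_zero]
  · exact (g.pos x _ h).le

theorem coInner_eq_sum (he : e ∈ IsManifold.maximalAtlas (𝓡 n) ∞ M) (hx : x ∈ e.source)
    (θ η : TangentSpace (𝓡 n) x →L[ℝ] ℝ) :
    coInner g x θ η
      = ∑ i, ∑ j, θ (baseFrame e i x) * gInv g e x i j * η (baseFrame e j x) := by
  rw [coInner, sharp_eq_sum g he hx, map_sum]
  simp only [map_smul, smul_eq_mul, Finset.sum_mul]
  exact Finset.sum_congr rfl fun i _ => Finset.sum_congr rfl fun j _ => by ring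

end BaseMetricChart

/-! ### Christoffel symbols -/

section Christoffel

variable {e : Chart n M} {x : M} {g : BaseMetric n M} {D : BaseConnection n M}

theorem covariantDerivative_baseFrame (D : BaseConnection n M)
    (he : e ∈ IsManifold.maximalAtlas (𝓡 n) ∞ M) (hx : x ∈ e.source) (i j : Fin n) :
    D (baseFrame e j) x (baseFrame e i x) = ∑ k, christoffel D e k i j x • baseFrame e k x :=
  (sum_baseCoframe_smul he hx _).symm

theorem covariantDerivative_baseFrame_comm (hD : IsLeviCivita (fun x X Y => g.inner x X Y) D)
    (he : e ∈ IsManifold.maximalAtlas (𝓡 n) ∞ M) (hx : x ∈ e.source) (i j : Fin n) :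
    D (baseFrame e j) x (baseFrame e i x) = D (baseFrame e i) x (baseFrame e j x) := by
  have := hD.sub_eq_mlieBracket (diffFieldAt_baseFrame he hx i) (diffFieldAt_baseFrame he hx j)
  rwa [mlieBracket_baseFrame he hx, sub_eq_zero] at this

theorem christoffel_symm (hD : IsLeviCivita (fun x X Y => g.inner x X Y) D)
    (he : e ∈ IsManifold.maximalAtlas (𝓡 n) ∞ M) (hx : x ∈ e.source) (k i j : Fin n) :
    christoffel D e k i j x = christoffel D e k j i x := by
  rw [christoffel, christoffel, covariantDerivative_baseFrame_comm hD he hx]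

theorem inner_covariantDerivative_baseFrame (D : BaseConnection n M)
    (he : e ∈ IsManifold.maximalAtlas (𝓡 n) ∞ M) (hx : x ∈ e.source) (i j k : Fin n) :
    g.inner x (D (baseFrame e j) x (baseFrame e i x)) (baseFrame e k x)
      = ∑ l, christoffel D e l i j x * gMat g e x l k := by
  rw [covariantDerivative_baseFrame D he hx]
  simp [gMat]

/-- `∇g = 0` in coordinates. -/
theorem hasDirDeriv_gMat (hD : IsLeviCivita (fun x X Y => g.inner x X Y) D)
    (he : e ∈ IsManifold.maximalAtlas (𝓡 n) ∞ M) (hx : x ∈ e.source) (k i j : Fin n) :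
    HasDirDeriv (𝓡 n) x (baseFrame e k x) (fun y => gMat g e y i j)
      (∑ l, christoffel D e l k i x * gMat g e x l j
        + ∑ l, christoffel D e l k j x * gMat g e x i l) := by
  refine ⟨(contMDiffAt_gMat g he hx i j).mdifferentiableAt (by simp), ?_⟩
  have := hD.metric x (baseFrame e k x) _ _ (diffFieldAt_baseFrame he hx i)
    (diffFieldAt_baseFrame he hx j)
  simp only [g.symm x (baseFrame e i x), inner_covariantDerivative_baseFrame D he hx] at this
  rw [Finset.sum_congr rfl fun l _ => congrArg _ (gMat_symm g i l)]
  exact this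

/-- The classical formula for the Christoffel symbols, by which they are smooth: nothing is assumed
about the smoothness of the connection. -/
theorem christoffel_eq (hD : IsLeviCivita (fun x X Y => g.inner x X Y) D)
    (he : e ∈ IsManifold.maximalAtlas (𝓡 n) ∞ M) (hx : x ∈ e.source) (k i j : Fin n) :
    christoffel D e k i j x = ∑ l, (1 / 2) * gInv g e x k l *
      (mvfderiv (𝓡 n) (fun y => gMat g e y j l) x (baseFrame e i x)
        + mvfderiv (𝓡 n) (fun y => gMat g e y i l) x (baseFrame e j x)
        - mvfderiv (𝓡 n) (fun y => gMat g e y i j) x (baseFrame e l x)) := by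
  have h : ∀ l, ∑ m, gMat g e x l m * christoffel D e m i j x = (1 / 2) *
      (mvfderiv (𝓡 n) (fun y => gMat g e y j l) x (baseFrame e i x)
        + mvfderiv (𝓡 n) (fun y => gMat g e y i l) x (baseFrame e j x)
        - mvfderiv (𝓡 n) (fun y => gMat g e y i j) x (baseFrame e l x)) := by
    intro l
    have hk := hD.koszul (x := x) (fun X Y => g.symm x X Y) (fun X Y Z => by simp)
      (diffFieldAt_baseFrame he hx i) (diffFieldAt_baseFrame he hx j)
      (diffFieldAt_baseFrame he hx l)
    simp only [inner_covariantDerivative_baseFrame D he hx, mlieBracket_baseFrame he hx,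
      map_zero, _root_.zero_apply, add_zero, sub_zero] at hk
    simp only [gMat_symm g l, mul_comm (gMat g e x _ l)]
    have e1 : ∀ a b : Fin n, (fun y => g.inner y (baseFrame e a y) (baseFrame e b y))
      = fun y => gMat g e y a b := fun _ _ => rfl
    rw [e1, e1, e1] at hk
    linarith
  simp only [mul_assoc, mul_left_comm (1 / 2 : ℝ), ← h]
  simp only [Finset.mul_sum, ← mul_assoc]
  rw [Finset.sum_comm]
  simp only [← Finset.sum_mul, sum_gInv_mul_gMat g he hx]
  simp

theorem contMDiffAt_christoffel (hD : IsLeviCivita (fun x X Y => g.inner x X Y) D)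
    (he : e ∈ IsManifold.maximalAtlas (𝓡 n) ∞ M) (hx : x ∈ e.source) (k i j : Fin n) :
    ContMDiffAt (𝓡 n) 𝓘(ℝ, ℝ) ∞ (christoffel D e k i j) x := by
  have h := fun a b c => contMDiffAt_mvfderiv_apply (contMDiffAt_gMat g he hx a b)
    (smoothFieldAt_baseFrame he hx c)
  refine ContMDiffAt.congr_of_eventuallyEq (f := fun x => ∑ l, (1 / 2) * gInv g e x k l *
      (mvfderiv (𝓡 n) (fun y => gMat g e y j l) x (baseFrame e i x)
        + mvfderiv (𝓡 n) (fun y => gMat g e y i l) x (baseFrame e j x)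
        - mvfderiv (𝓡 n) (fun y => gMat g e y i j) x (baseFrame e l x))) ?_ ?_
  · refine ContMDiffAt.sum fun l _ => ?_
    exact (contMDiffAt_const.mul (contMDiffAt_gInv g he hx k l)).mul
      (((h j l i).add (h i l j)).sub (h i j l))
  · filter_upwards [e.open_source.mem_nhds hx] with y hy
    exact christoffel_eq hD he hy k i j

/-- `∇g⁻¹ = 0` in coordinates. -/
theorem hasDirDeriv_gInv (hD : IsLeviCivita (fun x X Y => g.inner x X Y) D)
    (he : e ∈ IsManifold.maximalAtlas (𝓡 n) ∞ M) (hx : x ∈ e.source) (k i j : Fin n) :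
    HasDirDeriv (𝓡 n) x (baseFrame e k x) (fun y => gInv g e y i j)
      (-∑ l, christoffel D e i k l x * gInv g e x l j
        - ∑ l, christoffel D e j k l x * gInv g e x i l) := by
  refine ⟨(contMDiffAt_gInv g he hx i j).mdifferentiableAt (by simp), ?_⟩
  -- differentiate the identity `g^{il} g_{lm} = δ^i_m` and contract with `g^{mj}`
  have h : ∀ i m, ∑ l, (mvfderiv (𝓡 n) (fun y => gInv g e y i l) x (baseFrame e k x)
        * gMat g e x l m
      + gInv g e x i l * (∑ a, christoffel D e a k l x * gMat g e x a m
        + ∑ a, christoffel D e a k m x * gMat g e x l a)) = 0 := by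
    intro i m
    have h1 : HasDirDeriv (𝓡 n) x (baseFrame e k x)
        (fun y => ∑ l, gInv g e y i l * gMat g e y l m) _ := HasDirDeriv.sum fun l _ =>
      HasDirDeriv.mul ⟨(contMDiffAt_gInv g he hx i l).mdifferentiableAt (by simp), rfl⟩
        (hasDirDeriv_gMat hD he hx k l m)
    have h2 : (fun y => ∑ l, gInv g e y i l * gMat g e y l m) =ᶠ[nhds x]
        fun _ => if i = m then 1 else 0 := by
      filter_upwards [e.open_source.mem_nhds hx] with y hy
      exact sum_gInv_mul_gMat g he hy i m
    have h3 := h1.2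
    rw [mvfderiv_congr h2, mvfderiv_const] at h3
    exact h3.symm
  let A : Matrix (Fin n) (Fin n) ℝ := .of fun a b =>
    mvfderiv (𝓡 n) (fun y => gInv g e y a b) x (baseFrame e k x)
  let C : Matrix (Fin n) (Fin n) ℝ := .of fun a b => christoffel D e a k b x
  have hA : A * gMat g e x + gInv g e x * (C.transpose * gMat g e x + gMat g e x * C) = 0 := by
    ext a m
    simp only [Matrix.add_apply, Matrix.mul_apply, ← Finset.sum_add_distrib, A, C, Matrix.of_apply,
      Matrix.transpose_apply, Matrix.zero_apply]
    rw [← h a m]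
    simp only [mul_comm (gMat g e x _ _) (christoffel D e _ _ _ _), Finset.sum_add_distrib]
  have h1 : gMat g e x * gInv g e x = 1 :=
    Matrix.mul_nonsing_inv _ (det_gMat_ne_zero g he hx).isUnit
  have h2 : gInv g e x * gMat g e x = 1 :=
    Matrix.nonsing_inv_mul _ (det_gMat_ne_zero g he hx).isUnit
  have h3 : A = -(C * gInv g e x) - gInv g e x * C.transpose := by
    -- the hypotheses are inserted by hand, since only ring identities are available without
    -- commutativity
    calc A = (A * gMat g e x + gInv g e x * (C.transpose * gMat g e x + gMat g e x * C))
            * gInv g e x - gInv g e x * C.transpose * (gMat g e x * gInv g e x)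
            - (gInv g e x * gMat g e x) * C * gInv g e x
            + A * (1 - gMat g e x * gInv g e x) := by noncomm_ring
      _ = _ := by
        rw [hA, h1, h2]
        noncomm_ring
  have h4 := congrFun (congrFun h3 i) j
  simp only [A, C, Matrix.sub_apply, Matrix.neg_apply, Matrix.mul_apply, Matrix.of_apply,
    Matrix.transpose_apply] at h4
  rw [h4]
  simp only [mul_comm (gInv g e x i _)]

end Christoffel

/-! ### The frames of the cotangent bundle -/

section ContinuousLinearMap

variable {V W ι : Type*} [AddCommGroup V] [Module ℝ V] [TopologicalSpace V] [AddCommGroup W]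
  [Module ℝ W] [TopologicalSpace W]

/-- This and the next two lemmas specialize general facts to continuous linear maps, as the search for
the general type classes is too slow on the tangent spaces of `T*M`. -/
theorem clm_map_add (L : V →L[ℝ] W) (v w : V) : L (v + w) = L v + L w := map_add L v w

theorem clm_map_smul (L : V →L[ℝ] W) (r : ℝ) (v : V) : L (r • v) = r • L v := map_smul L r v

theorem clm_map_sum_smul (L : V →L[ℝ] W) (s : Finset ι) (c : ι → ℝ) (v : ι → V) :
    L (∑ i ∈ s, c i • v i) = ∑ i ∈ s, c i • L (v i) := by
  rw [map_sum]
  simp only [map_smul]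

end ContinuousLinearMap

section Frames

variable {e : Chart n M} {p : Cotangent n M} {D : BaseConnection n M} {g : BaseMetric n M}

theorem smoothFieldAt_dp (he : e ∈ IsManifold.maximalAtlas (𝓡 n) ∞ M)
    (hp : p.proj ∈ e.source) (i : Fin n) : SmoothFieldAt (cotModel n) (dp e i) p :=
  smoothFieldAt_mpullback_const (contMDiffAt_inducedChart he hp)
    (isInvertible_mfderiv_inducedChart he hp) _

theorem smoothFieldAt_dq (he : e ∈ IsManifold.maximalAtlas (𝓡 n) ∞ M)
    (hp : p.proj ∈ e.source) (i : Fin n) : SmoothFieldAt (cotModel n) (dq e i) p :=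
  smoothFieldAt_mpullback_const (contMDiffAt_inducedChart he hp)
    (isInvertible_mfderiv_inducedChart he hp) _

theorem mvfderiv_inducedChart_dp (he : e ∈ IsManifold.maximalAtlas (𝓡 n) ∞ M)
    (hp : p.proj ∈ e.source) (i : Fin n) :
    mvfderiv (cotModel n) (inducedChart e) p (dp e i p) = (0, EuclideanSpace.single i 1) :=
  (isInvertible_mfderiv_inducedChart he hp).self_apply_inverse _

theorem mvfderiv_inducedChart_dq (he : e ∈ IsManifold.maximalAtlas (𝓡 n) ∞ M)
    (hp : p.proj ∈ e.source) (i : Fin n) :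
    mvfderiv (cotModel n) (inducedChart e) p (dq e i p) = (EuclideanSpace.single i 1, 0) :=
  (isInvertible_mfderiv_inducedChart he hp).self_apply_inverse _

theorem mvfderiv_inducedChart_injective (he : e ∈ IsManifold.maximalAtlas (𝓡 n) ∞ M)
    (hp : p.proj ∈ e.source) :
    Function.Injective (mvfderiv (cotModel n) (inducedChart e) p) := fun ξ ζ h => by
  have h' : mfderiv (cotModel n) 𝓘(ℝ, Coord n × Coord n) (inducedChart e) p ξ
    = mfderiv (cotModel n) 𝓘(ℝ, Coord n × Coord n) (inducedChart e) p ζ := h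
  have := congrArg (mfderiv (cotModel n) 𝓘(ℝ, Coord n × Coord n) (inducedChart e) p).inverse h'
  rwa [(isInvertible_mfderiv_inducedChart he hp).inverse_apply_self,
    (isInvertible_mfderiv_inducedChart he hp).inverse_apply_self] at this

theorem mvfderiv_comp_proj {f : M → ℝ} (hf : MDifferentiableAt (𝓡 n) 𝓘(ℝ, ℝ) f p.proj)
    (ξ : TangentSpace (cotModel n) p) :
    mvfderiv (cotModel n) (fun q : Cotangent n M => f q.proj) p ξ
      = mvfderiv (𝓡 n) f p.proj (projDeriv p ξ) :=
  mvfderiv_comp_apply p hf (mdifferentiableAt_proj p) ξ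

theorem mvfderiv_inducedChart_fst (he : e ∈ IsManifold.maximalAtlas (𝓡 n) ∞ M)
    (hp : p.proj ∈ e.source) (ξ : TangentSpace (cotModel n) p) :
    (mvfderiv (cotModel n) (inducedChart e) p ξ).1 = mvfderiv (𝓡 n) e p.proj (projDeriv p ξ) := by
  have h1 := congrArg (fun L => L ξ)
    ((ContinuousLinearMap.fst ℝ (Coord n) (Coord n)).hasMFDerivAt.comp p
      ((contMDiffAt_inducedChart he hp).mdifferentiableAt (by simp)).hasMFDerivAt).mfderiv
  have h2 := mfderiv_comp_apply p (I' := 𝓡 n) ((contMDiffAt_chart he hp).mdifferentiableAt (by simp))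
    (mdifferentiableAt_proj p) ξ
  exact h1.symm.trans h2

theorem mvfderiv_inducedChart_snd (he : e ∈ IsManifold.maximalAtlas (𝓡 n) ∞ M)
    (hp : p.proj ∈ e.source) (ξ : TangentSpace (cotModel n) p) (i : Fin n) :
    (mvfderiv (cotModel n) (inducedChart e) p ξ).2 i
      = mvfderiv (cotModel n) (fibreCoord e i) p ξ := by
  have h1 := congrArg (fun L => L ξ)
    (((EuclideanSpace.proj (𝕜 := ℝ) i : Coord n →L[ℝ] ℝ).comp
      (ContinuousLinearMap.snd ℝ (Coord n) (Coord n))).hasMFDerivAt.comp p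
      ((contMDiffAt_inducedChart he hp).mdifferentiableAt (by simp)).hasMFDerivAt).mfderiv
  exact h1.symm

theorem projDeriv_dp (he : e ∈ IsManifold.maximalAtlas (𝓡 n) ∞ M)
    (hp : p.proj ∈ e.source) (i : Fin n) : projDeriv p (dp e i p) = 0 := by
  apply mvfderiv_chart_injective he hp
  rw [← mvfderiv_inducedChart_fst he hp, mvfderiv_inducedChart_dp he hp, map_zero]

theorem projDeriv_dq (he : e ∈ IsManifold.maximalAtlas (𝓡 n) ∞ M)
    (hp : p.proj ∈ e.source) (i : Fin n) : projDeriv p (dq e i p) = baseFrame e i p.proj := by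
  apply mvfderiv_chart_injective he hp
  rw [← mvfderiv_inducedChart_fst he hp, mvfderiv_inducedChart_dq he hp,
    mvfderiv_chart_baseFrame he hp]

theorem mvfderiv_fibreCoord_dp (he : e ∈ IsManifold.maximalAtlas (𝓡 n) ∞ M)
    (hp : p.proj ∈ e.source) (i j : Fin n) :
    mvfderiv (cotModel n) (fibreCoord e i) p (dp e j p) = if i = j then 1 else 0 := by
  rw [← mvfderiv_inducedChart_snd he hp, mvfderiv_inducedChart_dp he hp]
  simp

theorem mvfderiv_fibreCoord_dq (he : e ∈ IsManifold.maximalAtlas (𝓡 n) ∞ M)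
    (hp : p.proj ∈ e.source) (i j : Fin n) :
    mvfderiv (cotModel n) (fibreCoord e i) p (dq e j p) = 0 := by
  rw [← mvfderiv_inducedChart_snd he hp, mvfderiv_inducedChart_dq he hp]
  simp

theorem vertPart_apply (D : BaseConnection n M) {Y : ∀ x : M, TangentSpace (𝓡 n) x}
    (hY : DiffFieldAt (𝓡 n) Y p.proj) (ξ : TangentSpace (cotModel n) p) :
    vertPart D p ξ (Y p.proj)
      = mvfderiv (cotModel n) (evalField Y) p ξ - p.2 (D Y p.proj (projDeriv p ξ)) :=
  TensorialAt.mkHom_apply _ hY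

/-- `vertPart` as a linear map. -/
def vertPartₗ (D : BaseConnection n M) (p : Cotangent n M) :
    TangentSpace (cotModel n) p →ₗ[ℝ] TangentSpace (𝓡 n) p.proj →L[ℝ] ℝ where
  toFun := vertPart D p
  map_add' ξ ζ := by
    ext v
    simp only [vertPart, TensorialAt.mkHom_apply_eq_extend, clm_map_add, _root_.add_apply]
    ring
  map_smul' r ξ := by
    ext v
    simp only [vertPart, TensorialAt.mkHom_apply_eq_extend, clm_map_smul, _root_.smul_apply,
      smul_eq_mul, RingHom.id_apply]
    ring

theorem vertPartₗ_apply (D : BaseConnection n M) (p : Cotangent n M)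
    (ξ : TangentSpace (cotModel n) p) : vertPartₗ D p ξ = vertPart D p ξ := rfl

/-- The horizontal and the vertical part determine a tangent vector of `T*M`. -/
theorem ext_projDeriv_vertPart (D : BaseConnection n M) {ξ ζ : TangentSpace (cotModel n) p}
    (h1 : projDeriv p ξ = projDeriv p ζ) (h2 : vertPart D p ξ = vertPart D p ζ) : ξ = ζ := by
  have he := IsManifold.chart_mem_maximalAtlas (I := 𝓡 n) (n := ∞) p.proj
  have hp := mem_chart_source (Coord n) p.proj
  apply mvfderiv_inducedChart_injective he hp
  refine Prod.ext ?_ ?_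
  · rw [mvfderiv_inducedChart_fst he hp, mvfderiv_inducedChart_fst he hp, h1]
  · ext i
    rw [mvfderiv_inducedChart_snd he hp, mvfderiv_inducedChart_snd he hp]
    have := congrArg (fun θ => θ (baseFrame (chartAt (Coord n) p.proj) i p.proj)) h2
    simp only [vertPart_apply D (diffFieldAt_baseFrame he hp i), h1, sub_left_inj] at this
    exact this

theorem vertPart_dp (he : e ∈ IsManifold.maximalAtlas (𝓡 n) ∞ M)
    (hp : p.proj ∈ e.source) (i j : Fin n) :
    vertPart D p (dp e i p) (baseFrame e j p.proj) = if j = i then 1 else 0 := by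
  rw [vertPart_apply D (diffFieldAt_baseFrame he hp j), projDeriv_dp he hp, map_zero, map_zero,
    sub_zero]
  exact mvfderiv_fibreCoord_dp he hp j i

theorem projDeriv_delta (D : BaseConnection n M) (he : e ∈ IsManifold.maximalAtlas (𝓡 n) ∞ M)
    (hp : p.proj ∈ e.source) (i : Fin n) :
    projDeriv p (delta D e i p) = baseFrame e i p.proj := by
  simp only [delta, clm_map_add, clm_map_sum_smul, projDeriv_dp he hp, projDeriv_dq he hp, smul_zero,
    Finset.sum_const_zero, add_zero]

theorem vertPart_delta (D : BaseConnection n M) (he : e ∈ IsManifold.maximalAtlas (𝓡 n) ∞ M)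
    (hp : p.proj ∈ e.source) (i : Fin n) : vertPart D p (delta D e i p) = 0 := by
  have h : ∀ h, vertPart D p (delta D e i p) (baseFrame e h p.proj) = 0 := by
    intro h
    rw [vertPart_apply D (diffFieldAt_baseFrame he hp h), projDeriv_delta D he hp,
      covariantDerivative_baseFrame D he hp]
    have h1 : mvfderiv (cotModel n) (evalField (baseFrame e h)) p (delta D e i p)
        = ∑ k, fibreCoord e k p * christoffel D e k i h p.proj := by
      have h2 : evalField (baseFrame e h) = fibreCoord (M := M) e h := rfl
      rw [h2, delta, clm_map_add, clm_map_sum_smul]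
      simp only [mvfderiv_fibreCoord_dp he hp, mvfderiv_fibreCoord_dq he hp]
      simp
    rw [h1]
    simp only [map_sum, map_smul, smul_eq_mul, fibreCoord, mul_comm, sub_self]
  rw [← covector_eq_sum he hp (vertPart D p _)]
  simp [h]

theorem eq_sum_delta_add_sum_dp (he : e ∈ IsManifold.maximalAtlas (𝓡 n) ∞ M)
    (hp : p.proj ∈ e.source) (ξ : TangentSpace (cotModel n) p) :
    ξ = ∑ h, baseCoframe e h p.proj (projDeriv p ξ) • delta D e h p
      + ∑ h, vertPart D p ξ (baseFrame e h p.proj) • dp e h p := by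
  have hv : ∀ i, vertPart D p (dp e i p) = coordCovector e i p.proj := by
    intro i
    rw [← covector_eq_sum he hp (vertPart D p _)]
    simp [vertPart_dp he hp]
  apply ext_projDeriv_vertPart D
  · simp only [clm_map_add, clm_map_sum_smul, projDeriv_dp he hp, projDeriv_delta D he hp, smul_zero,
      Finset.sum_const_zero, add_zero, sum_baseCoframe_smul he hp]
  · simp only [← vertPartₗ_apply, map_add, map_sum, map_smul]
    simp only [vertPartₗ_apply, vertPart_delta D he hp, hv, smul_zero,
      Finset.sum_const_zero, zero_add, covector_eq_sum he hp]

/-- Horizontal vectors differentiate the function `q ↦ q(Y)` through the covariant derivative of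
`Y`. -/
theorem mvfderiv_evalField (D : BaseConnection n M) {Y : ∀ x : M, TangentSpace (𝓡 n) x}
    (hY : DiffFieldAt (𝓡 n) Y p.proj) (ξ : TangentSpace (cotModel n) p) :
    mvfderiv (cotModel n) (evalField Y) p ξ
      = vertPart D p ξ (Y p.proj) + p.2 (D Y p.proj (projDeriv p ξ)) := by
  rw [vertPart_apply D hY]
  ring

theorem diffFieldAt_dp (he : e ∈ IsManifold.maximalAtlas (𝓡 n) ∞ M)
    (hp : p.proj ∈ e.source) (i : Fin n) : DiffFieldAt (cotModel n) (dp e i) p :=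
  (smoothFieldAt_dp he hp i).mdifferentiableAt (by simp)

theorem diffFieldAt_delta (hD : IsLeviCivita (fun x X Y => g.inner x X Y) D)
    (he : e ∈ IsManifold.maximalAtlas (𝓡 n) ∞ M)
    (hp : p.proj ∈ e.source) (i : Fin n) : DiffFieldAt (cotModel n) (delta D e i) p := by
  have h1 : ∀ h, MDifferentiableAt (cotModel n) 𝓘(ℝ, ℝ)
      (fun q : Cotangent n M => ∑ k, fibreCoord e k q * christoffel D e k i h q.proj) p := by
    intro h
    have := ContMDiffAt.sum (t := Finset.univ) fun k _ => (contMDiffAt_fibreCoord he hp k).mul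
      ((contMDiffAt_christoffel hD he hp k i h).comp p (contMDiffAt_cotangent_proj p))
    exact this.mdifferentiableAt (by simp)
  refine mdifferentiableAt_add_section ((smoothFieldAt_dq he hp i).mdifferentiableAt (by simp)) ?_
  exact MDifferentiableAt.sum_section fun h _ => (h1 h).smul_section (diffFieldAt_dp he hp h)

end Frames

/-! ### The lifted metric in the adapted frame -/

theorem clm_map_sub {V W : Type*} [AddCommGroup V] [Module ℝ V] [TopologicalSpace V]
    [AddCommGroup W] [Module ℝ W] [TopologicalSpace W] (L : V →L[ℝ] W) (v w : V) :
    L (v - w) = L v - L w := map_sub L v w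

theorem sum_mul_sum_rank_one (r s : ℝ) (K : Fin n → Fin n → ℝ) (u v a b : Fin n → ℝ) :
    ∑ i, a i * ∑ j, (r * K i j + s * (u i * v j)) * b j
      = r * ∑ i, ∑ j, a i * K i j * b j + s * ((∑ i, u i * a i) * ∑ j, v j * b j) := by
  rw [Finset.sum_mul_sum]
  simp only [Finset.mul_sum, ← Finset.sum_add_distrib]
  exact Finset.sum_congr rfl fun i _ => Finset.sum_congr rfl fun j _ => by ring

section LiftMetricFrame

variable {e : Chart n M} {p : Cotangent n M} {g : BaseMetric n M} {D : BaseConnection n M}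
  {c : Coefficients}

/-- The components of a tangent vector of `T*M` in the adapted frame `(δ/δqⁱ, ∂/∂p_j)`. -/
def frameComp (D : BaseConnection n M) (e : Chart n M) (p : Cotangent n M)
    (ξ : TangentSpace (cotModel n) p) : Fin n ⊕ Fin n → ℝ :=
  Sum.elim (fun h => baseCoframe e h p.proj (projDeriv p ξ))
    (fun h => vertPart D p ξ (baseFrame e h p.proj))

theorem frameComp_expansion (D : BaseConnection n M)
    (he : e ∈ IsManifold.maximalAtlas (𝓡 n) ∞ M) (hp : p.proj ∈ e.source)
    (ξ : TangentSpace (cotModel n) p) :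
    ξ = ∑ h, frameComp D e p ξ (.inl h) • delta D e h p
      + ∑ h, frameComp D e p ξ (.inr h) • dp e h p :=
  eq_sum_delta_add_sum_dp he hp ξ

theorem frameComp_sub (ξ ζ : TangentSpace (cotModel n) p) :
    frameComp D e p (ξ - ζ) = frameComp D e p ξ - frameComp D e p ζ := by
  have h1 : projDeriv p (ξ - ζ) = projDeriv p ξ - projDeriv p ζ :=
    clm_map_sub _ _ _
  have h2 : vertPart D p (ξ - ζ) = vertPart D p ξ - vertPart D p ζ :=
    (vertPartₗ D p).map_sub _ _
  funext k
  rcases k with k | k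
  · simp only [frameComp, Sum.elim_inl, h1, Pi.sub_apply, baseCoframe, clm_map_sub]
    rfl
  · simp only [frameComp, Sum.elim_inr, h2, Pi.sub_apply]
    rfl

theorem frameComp_delta (D : BaseConnection n M)
    (he : e ∈ IsManifold.maximalAtlas (𝓡 n) ∞ M) (hp : p.proj ∈ e.source) (i : Fin n) :
    frameComp D e p (delta D e i p) = Pi.single (.inl i) 1 := by
  funext k
  rcases k with k | k
  · simp [frameComp, projDeriv_delta D he hp, baseCoframe_baseFrame he hp, Pi.single_apply]
  · simp [frameComp, vertPart_delta D he hp]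

theorem frameComp_dp (D : BaseConnection n M)
    (he : e ∈ IsManifold.maximalAtlas (𝓡 n) ∞ M) (hp : p.proj ∈ e.source) (i : Fin n) :
    frameComp D e p (dp e i p) = Pi.single (.inr i) 1 := by
  funext k
  rcases k with k | k
  · simp [frameComp, projDeriv_dp he hp, baseCoframe]
  · simp [frameComp, vertPart_dp he hp, Pi.single_apply]

theorem energy_eq (he : e ∈ IsManifold.maximalAtlas (𝓡 n) ∞ M) (hp : p.proj ∈ e.source) :
    energy g p = (∑ i, fibreCoord e i p * g0 g e i p) / 2 := by
  rw [energy, coInner_eq_sum g he hp]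
  congr 1
  refine Finset.sum_congr rfl fun i _ => ?_
  rw [g0, Finset.mul_sum]
  refine Finset.sum_congr rfl fun j _ => ?_
  rw [gInv_symm g i j, fibreCoord, fibreCoord]
  ring

theorem coInner_fibre (he : e ∈ IsManifold.maximalAtlas (𝓡 n) ∞ M) (hp : p.proj ∈ e.source)
    (θ : TangentSpace (𝓡 n) p.proj →L[ℝ] ℝ) :
    coInner g p.proj p.2 θ = ∑ i, g0 g e i p * θ (baseFrame e i p.proj) := by
  rw [coInner_eq_sum g he hp, Finset.sum_comm]
  refine Finset.sum_congr rfl fun i _ => ?_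
  rw [g0, Finset.sum_mul]
  rfl

theorem clm_apply_eq_sum (he : e ∈ IsManifold.maximalAtlas (𝓡 n) ∞ M) {x : M}
    (hx : x ∈ e.source) (θ : TangentSpace (𝓡 n) x →L[ℝ] ℝ) (X : TangentSpace (𝓡 n) x) :
    θ X = ∑ i, θ (baseFrame e i x) * baseCoframe e i x X := by
  conv_lhs => rw [← sum_baseCoframe_smul he hx X, clm_map_sum_smul]
  simp only [smul_eq_mul, mul_comm]

/-- In the adapted frame the lifted metric has the matrix `bigMat`. -/
theorem liftMetric_eq (D : BaseConnection n M) (c : Coefficients)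
    (he : e ∈ IsManifold.maximalAtlas (𝓡 n) ∞ M) (hp : p.proj ∈ e.source)
    (ξ ζ : TangentSpace (cotModel n) p) :
    liftMetric g D c p ξ ζ
      = frameComp D e p ξ ⬝ᵥ (bigMat g c e p).mulVec (frameComp D e p ζ) := by
  have hg : g.inner p.proj (projDeriv p ξ) (projDeriv p ζ)
      = ∑ i, ∑ j, frameComp D e p ξ (.inl i) * gMat g e p.proj i j
        * frameComp D e p ζ (.inl j) := by
    rw [← inner_sum_smul_baseFrame]
    simp only [frameComp, Sum.elim_inl, sum_baseCoframe_smul he hp]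
  have hp1 : ∀ ξ, p.2 (projDeriv p ξ) = ∑ i, fibreCoord e i p * frameComp D e p ξ (.inl i) :=
    fun ξ => clm_apply_eq_sum he hp _ _
  have hη : ∀ ξ ζ, vertPart D p ζ (projDeriv p ξ)
      = ∑ i, frameComp D e p ζ (.inr i) * frameComp D e p ξ (.inl i) :=
    fun ξ ζ => clm_apply_eq_sum he hp _ _
  have hc : coInner g p.proj (vertPart D p ξ) (vertPart D p ζ)
      = ∑ i, ∑ j, frameComp D e p ξ (.inr i) * gInv g e p.proj i j
        * frameComp D e p ζ (.inr j) := coInner_eq_sum g he hp _ _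
  have hc0 : ∀ ξ, coInner g p.proj p.2 (vertPart D p ξ)
      = ∑ i, g0 g e i p * frameComp D e p ξ (.inr i) := fun ξ => coInner_fibre he hp _
  simp only [liftMetric, hg, hp1, hη, hc, hc0]
  simp only [dotProduct, Matrix.mulVec, Fintype.sum_sum_type, bigMat, Matrix.fromBlocks_apply₁₁,
    Matrix.fromBlocks_apply₁₂, Matrix.fromBlocks_apply₂₁, Matrix.fromBlocks_apply₂₂,
    Matrix.of_apply, G1, G2, G3]
  generalize frameComp D e p ξ = a
  generalize frameComp D e p ζ = b
  simp only [mul_add, Finset.sum_add_distrib]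
  rw [sum_mul_sum_rank_one _ _ (gMat g e p.proj), sum_mul_sum_rank_one _ _ (gInv g e p.proj),
    sum_mul_sum_rank_one _ _ fun i j => if i = j then (1 : ℝ) else 0]
  have h12 := sum_mul_sum_rank_one (c.c₃ (energy g p)) (c.d₃ (energy g p))
    (fun i j => if j = i then (1 : ℝ) else 0) (fun i => fibreCoord e i p) (fun i => g0 g e i p)
    (fun i => a (.inl i)) (fun i => b (.inr i))
  simp only [mul_comm (fibreCoord e _ p) (g0 g e _ p)] at h12
  rw [h12]
  simp only [mul_ite, mul_one, mul_zero, ite_mul, zero_mul, Finset.sum_ite_eq, Finset.sum_ite_eq',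
    Finset.mem_univ, if_true]
  simp only [mul_comm (b (.inr _)) (a (.inl _))]
  ring

theorem G1_symm (i j : Fin n) : G1 g c e i j p = G1 g c e j i p := by
  rw [G1, G1, gMat_symm g i j, mul_comm (fibreCoord e i p)]

theorem G2_symm (i j : Fin n) : G2 g c e i j p = G2 g c e j i p := by
  rw [G2, G2, gInv_symm g i j, mul_comm (g0 g e i p)]

theorem bigMat_transpose : (bigMat g c e p).transpose = bigMat g c e p := by
  ext i j
  rcases i with i | i <;> rcases j with j | j
  · exact G1_symm j i
  · rfl
  · rfl
  · exact G2_symm j i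

theorem bigMat_inv_symm (i j : Fin n ⊕ Fin n) :
    (bigMat g c e p)⁻¹ i j = (bigMat g c e p)⁻¹ j i := by
  have h2 : ((bigMat g c e p)⁻¹).transpose = (bigMat g c e p)⁻¹ := by
    rw [Matrix.transpose_nonsing_inv, bigMat_transpose]
  exact congrFun (congrFun h2 j) i

theorem liftMetric_symm (g : BaseMetric n M) (D : BaseConnection n M) (c : Coefficients)
    (ξ ζ : TangentSpace (cotModel n) p) : liftMetric g D c p ξ ζ = liftMetric g D c p ζ ξ := by
  have he := IsManifold.chart_mem_maximalAtlas (I := 𝓡 n) (n := ∞) p.proj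
  have hp := mem_chart_source (Coord n) p.proj
  rw [liftMetric_eq D c he hp, liftMetric_eq D c he hp, Matrix.dotProduct_mulVec,
    dotProduct_comm, ← Matrix.mulVec_transpose, bigMat_transpose]

theorem liftMetric_sub_left (g : BaseMetric n M) (D : BaseConnection n M) (c : Coefficients)
    (ξ ζ χ : TangentSpace (cotModel n) p) :
    liftMetric g D c p (ξ - ζ) χ = liftMetric g D c p ξ χ - liftMetric g D c p ζ χ := by
  have he := IsManifold.chart_mem_maximalAtlas (I := 𝓡 n) (n := ∞) p.proj
  have hp := mem_chart_source (Coord n) p.proj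
  rw [liftMetric_eq D c he hp, liftMetric_eq D c he hp, liftMetric_eq D c he hp, frameComp_sub,
    sub_dotProduct]

theorem liftMetric_delta (D : BaseConnection n M) (c : Coefficients)
    (he : e ∈ IsManifold.maximalAtlas (𝓡 n) ∞ M) (hp : p.proj ∈ e.source)
    (ξ : TangentSpace (cotModel n) p) (k : Fin n) :
    liftMetric g D c p ξ (delta D e k p)
      = (bigMat g c e p).mulVec (frameComp D e p ξ) (.inl k) := by
  rw [liftMetric_symm, liftMetric_eq D c he hp, frameComp_delta D he hp, single_one_dotProduct]

theorem liftMetric_dp (D : BaseConnection n M) (c : Coefficients)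
    (he : e ∈ IsManifold.maximalAtlas (𝓡 n) ∞ M) (hp : p.proj ∈ e.source)
    (ξ : TangentSpace (cotModel n) p) (k : Fin n) :
    liftMetric g D c p ξ (dp e k p)
      = (bigMat g c e p).mulVec (frameComp D e p ξ) (.inr k) := by
  rw [liftMetric_symm, liftMetric_eq D c he hp, frameComp_dp D he hp, single_one_dotProduct]

theorem liftMetric_delta_delta (D : BaseConnection n M) (c : Coefficients)
    (he : e ∈ IsManifold.maximalAtlas (𝓡 n) ∞ M) (hp : p.proj ∈ e.source) (i j : Fin n) :
    liftMetric g D c p (delta D e i p) (delta D e j p) = G1 g c e i j p := by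
  rw [liftMetric_delta D c he hp, frameComp_delta D he hp, Matrix.mulVec_single_one]
  exact G1_symm j i

theorem liftMetric_dp_delta (D : BaseConnection n M) (c : Coefficients)
    (he : e ∈ IsManifold.maximalAtlas (𝓡 n) ∞ M) (hp : p.proj ∈ e.source) (i j : Fin n) :
    liftMetric g D c p (dp e i p) (delta D e j p) = G3 g c e i j p := by
  rw [liftMetric_delta D c he hp, frameComp_dp D he hp, Matrix.mulVec_single_one]
  rfl

theorem liftMetric_delta_dp (D : BaseConnection n M) (c : Coefficients)
    (he : e ∈ IsManifold.maximalAtlas (𝓡 n) ∞ M) (hp : p.proj ∈ e.source) (i j : Fin n) :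
    liftMetric g D c p (delta D e i p) (dp e j p) = G3 g c e j i p := by
  rw [liftMetric_symm, liftMetric_dp_delta D c he hp]

theorem liftMetric_dp_dp (D : BaseConnection n M) (c : Coefficients)
    (he : e ∈ IsManifold.maximalAtlas (𝓡 n) ∞ M) (hp : p.proj ∈ e.source) (i j : Fin n) :
    liftMetric g D c p (dp e i p) (dp e j p) = G2 g c e i j p := by
  rw [liftMetric_dp D c he hp, frameComp_dp D he hp, Matrix.mulVec_single_one]
  exact G2_symm j i

theorem det_bigMat_ne_zero (he : e ∈ IsManifold.maximalAtlas (𝓡 n) ∞ M) (hp : p.proj ∈ e.source)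
    (hG : ∀ ξ : TangentSpace (cotModel n) p, ξ ≠ 0 → 0 < liftMetric g D c p ξ ξ) :
    (bigMat g c e p).det ≠ 0 := by
  intro h
  obtain ⟨v, hv, h0⟩ := Matrix.exists_mulVec_eq_zero_iff.2 h
  set ξ : TangentSpace (cotModel n) p :=
    ∑ h, v (.inl h) • delta D e h p + ∑ h, v (.inr h) • dp e h p with hξ
  have hcomp : frameComp D e p ξ = v := by
    funext k
    rcases k with k | k
    · simp only [frameComp, Sum.elim_inl, hξ, clm_map_add, clm_map_sum_smul, projDeriv_dp he hp,
        projDeriv_delta D he hp, smul_zero, Finset.sum_const_zero, add_zero]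
      rw [← coordCovector_apply he hp, clm_map_sum_smul]
      simp [coordCovector_apply he hp, baseCoframe_baseFrame he hp]
    · change vertPartₗ D p ξ (baseFrame e k p.proj) = v (.inr k)
      simp only [hξ, map_add, map_sum, map_smul]
      simp [vertPartₗ_apply, vertPart_delta D he hp, vertPart_dp he hp]
  have hξ0 : ξ = 0 := by
    by_contra hne
    have := hG ξ hne
    rw [liftMetric_eq D c he hp, hcomp, h0, dotProduct_zero] at this
    exact lt_irrefl _ this
  apply hv
  rw [← hcomp, hξ0, ← sub_self (0 : TangentSpace (cotModel n) p), frameComp_sub, sub_self]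

/-- The components of a tangent vector of `T*M` are recovered from its scalar products with the
vectors of the adapted frame by means of the inverse matrix. -/
theorem eq_sum_of_liftMetric (he : e ∈ IsManifold.maximalAtlas (𝓡 n) ∞ M) (hp : p.proj ∈ e.source)
    (hG : ∀ ξ : TangentSpace (cotModel n) p, ξ ≠ 0 → 0 < liftMetric g D c p ξ ξ)
    {ξ : TangentSpace (cotModel n) p} {a b : Fin n → ℝ}
    (ha : ∀ k, liftMetric g D c p ξ (delta D e k p) = a k)
    (hb : ∀ k, liftMetric g D c p ξ (dp e k p) = b k) :
    ξ = ∑ h, (∑ k, b k * H3 g c e h k p + ∑ k, a k * H1 g c e k h p) • delta D e h p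
      + ∑ h, (∑ k, b k * H2 g c e k h p + ∑ k, a k * H3 g c e k h p) • dp e h p := by
  have h1 : (bigMat g c e p).mulVec (frameComp D e p ξ) = Sum.elim a b := by
    funext k
    rcases k with k | k
    · rw [← liftMetric_delta D c he hp, ha]; rfl
    · rw [← liftMetric_dp D c he hp, hb]; rfl
  have h2 : frameComp D e p ξ = (bigMat g c e p)⁻¹.mulVec (Sum.elim a b) := by
    rw [← h1, Matrix.mulVec_mulVec,
      Matrix.nonsing_inv_mul _ (det_bigMat_ne_zero he hp hG).isUnit, Matrix.one_mulVec]
  conv_lhs => rw [frameComp_expansion D he hp ξ, h2]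
  simp only [Matrix.mulVec, dotProduct, Fintype.sum_sum_type, Sum.elim_inl, Sum.elim_inr]
  congr 1
  · refine Finset.sum_congr rfl fun h _ => ?_
    rw [add_comm]
    simp only [H3, H1, mul_comm, bigMat_inv_symm (.inl h) (.inl _)]
  · refine Finset.sum_congr rfl fun h _ => ?_
    rw [add_comm]
    simp only [H3, H2, mul_comm, bigMat_inv_symm (.inr h) _]

end LiftMetricFrame

/-! ### Brackets of the adapted frame -/

section Brackets

variable {e : Chart n M} {p : Cotangent n M} {g : BaseMetric n M} {D : BaseConnection n M}
  {c : Coefficients}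

/-- If two vector fields project to constant combinations of coordinate fields, then their bracket
is vertical. -/
theorem projDeriv_mlieBracket_eq_zero (he : e ∈ IsManifold.maximalAtlas (𝓡 n) ∞ M)
    (hp : p.proj ∈ e.source) {V W : ∀ q : Cotangent n M, TangentSpace (cotModel n) q}
    (hV : DiffFieldAt (cotModel n) V p) (hW : DiffFieldAt (cotModel n) W p) {v w : Fin n → ℝ}
    (hv : ∀ᶠ q in nhds p, ∀ k, baseCoframe e k q.proj (projDeriv q (V q)) = v k)
    (hw : ∀ᶠ q in nhds p, ∀ k, baseCoframe e k q.proj (projDeriv q (W q)) = w k) :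
    projDeriv p (VectorField.mlieBracket (cotModel n) V W p) = 0 := by
  have hd : ∀ k, ∀ q : Cotangent n M, q.proj ∈ e.source → ∀ ξ : TangentSpace (cotModel n) q,
      mvfderiv (cotModel n) (fun q : Cotangent n M => e q.proj k) q ξ
        = baseCoframe e k q.proj (projDeriv q ξ) := by
    intro k q hq ξ
    rw [mvfderiv_comp_proj (f := fun y => e y k)
      ((contMDiffAt_chart_apply he hq k).mdifferentiableAt (by simp)), ← coordCovector_apply he hq]
    rfl
  have hs := eventually_proj_mem e hp
  have key : ∀ k, baseCoframe e k p.proj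
      (projDeriv p (VectorField.mlieBracket (cotModel n) V W p)) = 0 := by
    intro k
    have hsm : ContMDiffAt (cotModel n) 𝓘(ℝ, ℝ) ∞ (fun q : Cotangent n M => e q.proj k) p :=
      (contMDiffAt_chart_apply he hp k).comp p (contMDiffAt_cotangent_proj p)
    rw [← hd k p hp, mvfderiv_mlieBracket hsm hV hW]
    have h1 : (fun q : Cotangent n M =>
        mvfderiv (cotModel n) (fun q : Cotangent n M => e q.proj k) q (V q))
        =ᶠ[nhds p] fun _ => v k := by
      filter_upwards [hs, hv] with q hq hq'
      rw [hd k q hq, hq']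
    have h2 : (fun q : Cotangent n M =>
        mvfderiv (cotModel n) (fun q : Cotangent n M => e q.proj k) q (W q))
        =ᶠ[nhds p] fun _ => w k := by
      filter_upwards [hs, hw] with q hq hq'
      rw [hd k q hq, hq']
    have h3 := mvfderiv_congr (I := cotModel n) h1
    have h4 := mvfderiv_congr (I := cotModel n) h2
    rw [mvfderiv_const] at h3 h4
    refine (congrArg₂ (fun a b => a - b) (congrArg (fun L => L (V p)) h4)
      (congrArg (fun L => L (W p)) h3)).trans ?_
    simp
  rw [← sum_baseCoframe_smul he hp (projDeriv p _)]
  simp [key]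

/-- The components of a vertical vector are its derivatives of the fibre coordinates. -/
theorem vertical_eq_sum (D : BaseConnection n M) (he : e ∈ IsManifold.maximalAtlas (𝓡 n) ∞ M)
    (hp : p.proj ∈ e.source) {χ : TangentSpace (cotModel n) p} (hχ : projDeriv p χ = 0)
    {u : Fin n → ℝ} (hu : ∀ h, mvfderiv (cotModel n) (fibreCoord e h) p χ = u h) :
    χ = ∑ h, u h • dp e h p := by
  have h1 : ∀ h, vertPart D p χ (baseFrame e h p.proj) = u h := by
    intro h
    rw [vertPart_apply D (diffFieldAt_baseFrame he hp h), hχ, map_zero, map_zero, sub_zero]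
    exact hu h
  have h2 := frameComp_expansion D he hp χ
  simp only [frameComp, Sum.elim_inl, Sum.elim_inr, h1, hχ, baseCoframe, map_zero] at h2
  simpa using h2

theorem eventually_baseCoframe_delta (D : BaseConnection n M)
    (he : e ∈ IsManifold.maximalAtlas (𝓡 n) ∞ M) (hp : p.proj ∈ e.source) (i : Fin n) :
    ∀ᶠ q in nhds p, ∀ k, baseCoframe e k q.proj (projDeriv q (delta D e i q))
      = if k = i then 1 else 0 := by
  filter_upwards [eventually_proj_mem e hp] with q hq k
  rw [projDeriv_delta D he hq, baseCoframe_baseFrame he hq]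

theorem eventually_baseCoframe_dp
    (he : e ∈ IsManifold.maximalAtlas (𝓡 n) ∞ M) (hp : p.proj ∈ e.source) (i : Fin n) :
    ∀ᶠ q in nhds p, ∀ k, baseCoframe e k q.proj (projDeriv q (dp e i q)) = 0 := by
  filter_upwards [eventually_proj_mem e hp] with q hq k
  rw [projDeriv_dp he hq, baseCoframe, map_zero]
  rfl

theorem mvfderiv_fibreCoord_delta (D : BaseConnection n M)
    (he : e ∈ IsManifold.maximalAtlas (𝓡 n) ∞ M) (hp : p.proj ∈ e.source) (h j : Fin n) :
    mvfderiv (cotModel n) (fibreCoord e h) p (delta D e j p)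
      = p.2 (D (baseFrame e h) p.proj (baseFrame e j p.proj)) := by
  have := mvfderiv_evalField D (diffFieldAt_baseFrame he hp h) (delta D e j p)
  rw [vertPart_delta D he hp, projDeriv_delta D he hp, _root_.zero_apply,
    zero_add] at this
  exact this

theorem fibre_covariantDerivative (D : BaseConnection n M)
    (he : e ∈ IsManifold.maximalAtlas (𝓡 n) ∞ M) (hp : p.proj ∈ e.source) (h j : Fin n) :
    p.2 (D (baseFrame e h) p.proj (baseFrame e j p.proj))
      = ∑ k, fibreCoord e k p * christoffel D e k j h p.proj := by
  rw [covariantDerivative_baseFrame D he hp, clm_map_sum_smul]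
  exact Finset.sum_congr rfl fun k _ => mul_comm _ _

theorem hasDirDeriv_fibreCoord_dp (he : e ∈ IsManifold.maximalAtlas (𝓡 n) ∞ M)
    (hp : p.proj ∈ e.source) (i j : Fin n) :
    HasDirDeriv (cotModel n) p (dp e j p) (fibreCoord e i) (if i = j then 1 else 0) :=
  ⟨(contMDiffAt_fibreCoord he hp i).mdifferentiableAt (by simp), mvfderiv_fibreCoord_dp he hp i j⟩

theorem hasDirDeriv_comp_proj {f : M → ℝ} {a : ℝ} {ξ : TangentSpace (cotModel n) p}
    (hf : HasDirDeriv (𝓡 n) p.proj (projDeriv p ξ) f a) :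
    HasDirDeriv (cotModel n) p ξ (fun q : Cotangent n M => f q.proj) a :=
  ⟨hf.1.comp p (mdifferentiableAt_proj p), by rw [mvfderiv_comp_proj hf.1, hf.2]⟩

theorem hasDirDeriv_comp_proj_dp (he : e ∈ IsManifold.maximalAtlas (𝓡 n) ∞ M)
    (hp : p.proj ∈ e.source) {f : M → ℝ} (hf : MDifferentiableAt (𝓡 n) 𝓘(ℝ, ℝ) f p.proj)
    (i : Fin n) :
    HasDirDeriv (cotModel n) p (dp e i p) (fun q : Cotangent n M => f q.proj) 0 :=
  hasDirDeriv_comp_proj ⟨hf, by rw [projDeriv_dp he hp, map_zero]⟩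

theorem mlieBracket_dp_dp (D : BaseConnection n M) (he : e ∈ IsManifold.maximalAtlas (𝓡 n) ∞ M)
    (hp : p.proj ∈ e.source) (i j : Fin n) :
    VectorField.mlieBracket (cotModel n) (dp e i) (dp e j) p = 0 := by
  have h1 : ∀ h i j, mvfderiv (cotModel n)
      (fun q => mvfderiv (cotModel n) (fibreCoord e h) q (dp e i q)) p (dp e j p) = 0 := by
    intro h i j
    refine ((HasDirDeriv.const (if h = i then 1 else 0)).congr ?_ rfl).2
    filter_upwards [eventually_proj_mem e hp] with q hq
    exact mvfderiv_fibreCoord_dp he hq h i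
  refine (vertical_eq_sum D he hp (projDeriv_mlieBracket_eq_zero he hp (diffFieldAt_dp he hp i)
    (diffFieldAt_dp he hp j) (eventually_baseCoframe_dp he hp i)
    (eventually_baseCoframe_dp he hp j)) (u := 0) fun h => ?_).trans (by simp)
  rw [mvfderiv_mlieBracket (contMDiffAt_fibreCoord he hp h) (diffFieldAt_dp he hp i)
    (diffFieldAt_dp he hp j), h1, h1, sub_zero]
  rfl

theorem mlieBracket_dp_delta (hD : IsLeviCivita (fun x X Y => g.inner x X Y) D)
    (he : e ∈ IsManifold.maximalAtlas (𝓡 n) ∞ M) (hp : p.proj ∈ e.source) (i j : Fin n) :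
    VectorField.mlieBracket (cotModel n) (dp e i) (delta D e j) p
      = ∑ h, christoffel D e i j h p.proj • dp e h p := by
  refine vertical_eq_sum D he hp (projDeriv_mlieBracket_eq_zero he hp (diffFieldAt_dp he hp i)
    (diffFieldAt_delta hD he hp j) (eventually_baseCoframe_dp he hp i)
    (eventually_baseCoframe_delta D he hp j)) fun h => ?_
  rw [mvfderiv_mlieBracket (contMDiffAt_fibreCoord he hp h) (diffFieldAt_dp he hp i)
    (diffFieldAt_delta hD he hp j)]
  have h1 : HasDirDeriv (cotModel n) p (dp e i p)
      (fun q => mvfderiv (cotModel n) (fibreCoord e h) q (delta D e j q))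
      (christoffel D e i j h p.proj) := by
    refine (HasDirDeriv.sum (s := Finset.univ) fun k _ =>
      (hasDirDeriv_fibreCoord_dp he hp k i).mul (hasDirDeriv_comp_proj_dp he hp
        ((contMDiffAt_christoffel hD he hp k j h).mdifferentiableAt (by simp)) i)).congr ?_ ?_
    · filter_upwards [eventually_proj_mem e hp] with q hq
      rw [mvfderiv_fibreCoord_delta D he hq, fibre_covariantDerivative D he hq]
    · simp
  have h2 : HasDirDeriv (cotModel n) p (delta D e j p)
      (fun q => mvfderiv (cotModel n) (fibreCoord e h) q (dp e i q)) 0 := by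
    refine (HasDirDeriv.const (if h = i then 1 else 0)).congr ?_ rfl
    filter_upwards [eventually_proj_mem e hp] with q hq
    exact mvfderiv_fibreCoord_dp he hq h i
  rw [h1.2, h2.2, sub_zero]

theorem diffFieldAt_covariantDerivative_baseFrame
    (hD : IsLeviCivita (fun x X Y => g.inner x X Y) D)
    (he : e ∈ IsManifold.maximalAtlas (𝓡 n) ∞ M) {x : M} (hx : x ∈ e.source) (i j : Fin n) :
    DiffFieldAt (𝓡 n) (fun y => D (baseFrame e j) y (baseFrame e i y)) x := by
  have h1 : DiffFieldAt (𝓡 n) (fun y => ∑ k, christoffel D e k i j y • baseFrame e k y) x :=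
    MDifferentiableAt.sum_section fun k _ =>
      ((contMDiffAt_christoffel hD he hx k i j).mdifferentiableAt (by simp)).smul_section
        (diffFieldAt_baseFrame he hx k)
  refine h1.congr_of_eventuallyEq ?_
  filter_upwards [e.open_source.mem_nhds hx] with y hy
  rw [covariantDerivative_baseFrame D he hy]

theorem curvature_baseFrame (D : BaseConnection n M)
    (he : e ∈ IsManifold.maximalAtlas (𝓡 n) ∞ M) {x : M} (hx : x ∈ e.source) (i j k : Fin n) :
    curvature D (baseFrame e i) (baseFrame e j) (baseFrame e k) x
      = D (fun y => D (baseFrame e k) y (baseFrame e j y)) x (baseFrame e i x)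
        - D (fun y => D (baseFrame e k) y (baseFrame e i y)) x (baseFrame e j x) := by
  rw [curvature, mlieBracket_baseFrame he hx, map_zero, sub_zero]

theorem curv0_eq (D : BaseConnection n M) (he : e ∈ IsManifold.maximalAtlas (𝓡 n) ∞ M)
    (hp : p.proj ∈ e.source) (k i j : Fin n) :
    curv0 D e k i j p
      = p.2 (curvature D (baseFrame e i) (baseFrame e j) (baseFrame e k) p.proj) :=
  (clm_apply_eq_sum he hp _ _).symm

/-- The curvature is the obstruction to the integrability of the horizontal distribution. -/
theorem mlieBracket_delta_delta (hD : IsLeviCivita (fun x X Y => g.inner x X Y) D)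
    (he : e ∈ IsManifold.maximalAtlas (𝓡 n) ∞ M) (hp : p.proj ∈ e.source) (i j : Fin n) :
    VectorField.mlieBracket (cotModel n) (delta D e i) (delta D e j) p
      = ∑ h, curv0 D e h i j p • dp e h p := by
  refine vertical_eq_sum D he hp (projDeriv_mlieBracket_eq_zero he hp (diffFieldAt_delta hD he hp i)
    (diffFieldAt_delta hD he hp j) (eventually_baseCoframe_delta D he hp i)
    (eventually_baseCoframe_delta D he hp j)) fun h => ?_
  rw [mvfderiv_mlieBracket (contMDiffAt_fibreCoord he hp h) (diffFieldAt_delta hD he hp i)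
    (diffFieldAt_delta hD he hp j)]
  have h1 : ∀ i j, mvfderiv (cotModel n)
      (fun q => mvfderiv (cotModel n) (fibreCoord e h) q (delta D e j q)) p (delta D e i p)
      = p.2 (D (fun y => D (baseFrame e h) y (baseFrame e j y)) p.proj (baseFrame e i p.proj)) := by
    intro i j
    have : (fun q => mvfderiv (cotModel n) (fibreCoord e h) q (delta D e j q)) =ᶠ[nhds p]
        evalField (fun y => D (baseFrame e h) y (baseFrame e j y)) := by
      filter_upwards [eventually_proj_mem e hp] with q hq
      rw [mvfderiv_fibreCoord_delta D he hq]
      rfl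
    rw [mvfderiv_congr this, mvfderiv_evalField D
      (diffFieldAt_covariantDerivative_baseFrame hD he hp j h), vertPart_delta D he hp,
      projDeriv_delta D he hp]
    simp
  rw [h1, h1, curv0_eq D he hp, curvature_baseFrame D he hp]
  exact (map_sub _ _ _).symm

theorem curv0_antisymm (D : BaseConnection n M) (he : e ∈ IsManifold.maximalAtlas (𝓡 n) ∞ M)
    (hp : p.proj ∈ e.source) (k i j : Fin n) : curv0 D e k i j p = -curv0 D e k j i p := by
  rw [curv0_eq D he hp, curv0_eq D he hp, curvature_baseFrame D he hp, curvature_baseFrame D he hp,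
    ← neg_sub]
  exact map_neg _ _

/-- The first Bianchi identity. -/
theorem curv0_bianchi (hD : IsLeviCivita (fun x X Y => g.inner x X Y) D)
    (he : e ∈ IsManifold.maximalAtlas (𝓡 n) ∞ M) (hp : p.proj ∈ e.source) (i j k : Fin n) :
    curv0 D e k i j p + curv0 D e i j k p + curv0 D e j k i p = 0 := by
  have h1 : ∀ a b, D (fun y => D (baseFrame e a) y (baseFrame e b y)) p.proj
      = D (fun y => D (baseFrame e b) y (baseFrame e a y)) p.proj := by
    intro a b
    refine covariantDerivative_congr D (diffFieldAt_covariantDerivative_baseFrame hD he hp b a) ?_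
    filter_upwards [e.open_source.mem_nhds hp] with y hy
    exact covariantDerivative_baseFrame_comm hD he hy b a
  rw [curv0_eq D he hp, curv0_eq D he hp, curv0_eq D he hp, curvature_baseFrame D he hp,
    curvature_baseFrame D he hp, curvature_baseFrame D he hp, h1 k j, h1 k i, h1 i j,
    ← map_add, ← map_add]
  simp

end Brackets

/-! ### Horizontal derivatives of the metric components -/

section HorizontalDerivatives

variable {e : Chart n M} {p : Cotangent n M} {g : BaseMetric n M} {D : BaseConnection n M}

theorem hasDirDeriv_fibreCoord_delta (D : BaseConnection n M)
    (he : e ∈ IsManifold.maximalAtlas (𝓡 n) ∞ M) (hp : p.proj ∈ e.source) (k i : Fin n) :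
    HasDirDeriv (cotModel n) p (delta D e k p) (fibreCoord e i)
      (∑ l, christoffel D e l k i p.proj * fibreCoord e l p) :=
  ⟨(contMDiffAt_fibreCoord he hp i).mdifferentiableAt (by simp), by
    rw [mvfderiv_fibreCoord_delta D he hp, fibre_covariantDerivative D he hp]
    simp only [mul_comm]⟩

theorem hasDirDeriv_comp_proj_delta (D : BaseConnection n M)
    (he : e ∈ IsManifold.maximalAtlas (𝓡 n) ∞ M) (hp : p.proj ∈ e.source) {k : Fin n}
    {f : M → ℝ} {a : ℝ} (hf : HasDirDeriv (𝓡 n) p.proj (baseFrame e k p.proj) f a) :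
    HasDirDeriv (cotModel n) p (delta D e k p) (fun q : Cotangent n M => f q.proj) a :=
  hasDirDeriv_comp_proj (by rwa [projDeriv_delta D he hp])

theorem hasDirDeriv_g0_delta (hD : IsLeviCivita (fun x X Y => g.inner x X Y) D)
    (he : e ∈ IsManifold.maximalAtlas (𝓡 n) ∞ M) (hp : p.proj ∈ e.source) (k i : Fin n) :
    HasDirDeriv (cotModel n) p (delta D e k p) (g0 g e i)
      (-∑ l, christoffel D e i k l p.proj * g0 g e l p) := by
  refine (HasDirDeriv.sum (s := Finset.univ) fun h _ =>
    (hasDirDeriv_fibreCoord_delta D he hp k h).mul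
      (hasDirDeriv_comp_proj_delta D he hp (hasDirDeriv_gInv hD he hp k h i))).congr
    Filter.EventuallyEq.rfl ?_
  simp only [g0, mul_sub, mul_neg, Finset.mul_sum, Finset.sum_mul, Finset.sum_add_distrib,
    Finset.sum_sub_distrib, Finset.sum_neg_distrib]
  rw [Finset.sum_comm, add_sub, ← sub_eq_add_neg]
  have h1 : ∀ a b : Fin n, christoffel D e a k b p.proj * fibreCoord e a p * gInv g e p.proj b i
      = fibreCoord e a p * (christoffel D e a k b p.proj * gInv g e p.proj b i) :=
    fun a b => by ring
  simp only [h1, sub_self, zero_sub, neg_inj]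
  rw [Finset.sum_comm]
  exact Finset.sum_congr rfl fun _ _ => Finset.sum_congr rfl fun _ _ => by ring

/-- Parallel transport preserves the length of covectors. -/
theorem hasDirDeriv_energy_delta (hD : IsLeviCivita (fun x X Y => g.inner x X Y) D)
    (he : e ∈ IsManifold.maximalAtlas (𝓡 n) ∞ M) (hp : p.proj ∈ e.source) (k : Fin n) :
    HasDirDeriv (cotModel n) p (delta D e k p) (energy g) 0 := by
  refine ((HasDirDeriv.sum (s := Finset.univ) fun i _ =>
    (hasDirDeriv_fibreCoord_delta D he hp k i).mul (hasDirDeriv_g0_delta hD he hp k i)).mul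
      (HasDirDeriv.const (1 / 2))).congr ?_ ?_
  · filter_upwards [eventually_proj_mem e hp] with q hq
    rw [energy_eq he hq, div_eq_mul_one_div]
  · simp only [mul_neg, Finset.mul_sum, Finset.sum_mul, Finset.sum_add_distrib,
      Finset.sum_neg_distrib, mul_zero, add_zero]
    rw [Finset.sum_comm]
    have h1 : ∀ a b : Fin n, christoffel D e a k b p.proj * fibreCoord e a p * g0 g e b p
        = fibreCoord e a p * (christoffel D e a k b p.proj * g0 g e b p) := fun a b => by ring
    simp only [h1, add_neg_cancel, zero_mul]

theorem energy_mem_Ici (g : BaseMetric n M) (q : Cotangent n M) : energy g q ∈ Ici (0 : ℝ) :=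
  div_nonneg (coInner_self_nonneg g q.proj q.2) (by norm_num)

/-- The derivative of `f` is taken within `[0, ∞)`, since the energy density takes the value `0` on the
zero section, where `f` is only smooth from the right. -/
theorem hasDirDeriv_comp_energy_delta (hD : IsLeviCivita (fun x X Y => g.inner x X Y) D)
    (he : e ∈ IsManifold.maximalAtlas (𝓡 n) ∞ M) (hp : p.proj ∈ e.source) (k : Fin n)
    {f : ℝ → ℝ} (hf : ContDiffOn ℝ ∞ f (Ici 0)) :
    HasDirDeriv (cotModel n) p (delta D e k p) (fun q => f (energy g q)) 0 := by
  have h1 := ((hf.differentiableOn (by simp)) _ (energy_mem_Ici g p)).hasDerivWithinAt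
  exact ((hasDirDeriv_energy_delta hD he hp k).comp_of_hasDerivWithinAt h1 (energy_mem_Ici g)).congr
    Filter.EventuallyEq.rfl (mul_zero _)

variable {c : Coefficients}

theorem hasDirDeriv_G1_delta (hD : IsLeviCivita (fun x X Y => g.inner x X Y) D)
    (he : e ∈ IsManifold.maximalAtlas (𝓡 n) ∞ M) (hp : p.proj ∈ e.source) (k i j : Fin n) :
    HasDirDeriv (cotModel n) p (delta D e k p) (G1 g c e i j)
      (∑ l, christoffel D e l k i p.proj * G1 g c e l j p
        + ∑ l, christoffel D e l k j p.proj * G1 g c e i l p) := by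
  refine (((hasDirDeriv_comp_energy_delta hD he hp k c.smooth_c₁).mul
    (hasDirDeriv_comp_proj_delta D he hp (hasDirDeriv_gMat hD he hp k i j))).add
    ((hasDirDeriv_comp_energy_delta hD he hp k c.smooth_d₁).mul
      ((hasDirDeriv_fibreCoord_delta D he hp k i).mul
        (hasDirDeriv_fibreCoord_delta D he hp k j)))).congr Filter.EventuallyEq.rfl ?_
  simp only [G1, zero_mul, zero_add, mul_add, Finset.mul_sum, Finset.sum_mul]
  simp only [← Finset.sum_add_distrib]
  exact Finset.sum_congr rfl fun _ _ => by ring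

theorem hasDirDeriv_G2_delta (hD : IsLeviCivita (fun x X Y => g.inner x X Y) D)
    (he : e ∈ IsManifold.maximalAtlas (𝓡 n) ∞ M) (hp : p.proj ∈ e.source) (k i j : Fin n) :
    HasDirDeriv (cotModel n) p (delta D e k p) (G2 g c e i j)
      (-∑ l, christoffel D e i k l p.proj * G2 g c e l j p
        - ∑ l, christoffel D e j k l p.proj * G2 g c e i l p) := by
  refine (((hasDirDeriv_comp_energy_delta hD he hp k c.smooth_c₂).mul
    (hasDirDeriv_comp_proj_delta D he hp (hasDirDeriv_gInv hD he hp k i j))).add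
    ((hasDirDeriv_comp_energy_delta hD he hp k c.smooth_d₂).mul
      ((hasDirDeriv_g0_delta hD he hp k i).mul
        (hasDirDeriv_g0_delta hD he hp k j)))).congr Filter.EventuallyEq.rfl ?_
  simp only [G2, zero_mul, zero_add, mul_add, Finset.mul_sum, Finset.sum_mul,
    ← Finset.sum_neg_distrib, ← Finset.sum_sub_distrib]
  simp only [← Finset.sum_add_distrib]
  exact Finset.sum_congr rfl fun _ _ => by ring

theorem hasDirDeriv_G3_delta (hD : IsLeviCivita (fun x X Y => g.inner x X Y) D)
    (he : e ∈ IsManifold.maximalAtlas (𝓡 n) ∞ M) (hp : p.proj ∈ e.source) (k i j : Fin n) :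
    HasDirDeriv (cotModel n) p (delta D e k p) (G3 g c e i j)
      (∑ l, christoffel D e l k j p.proj * G3 g c e i l p
        - ∑ l, christoffel D e i k l p.proj * G3 g c e l j p) := by
  refine (((hasDirDeriv_comp_energy_delta hD he hp k c.smooth_c₃).mul
    (HasDirDeriv.const (if i = j then 1 else 0))).add
    ((hasDirDeriv_comp_energy_delta hD he hp k c.smooth_d₃).mul
      ((hasDirDeriv_g0_delta hD he hp k i).mul
        (hasDirDeriv_fibreCoord_delta D he hp k j)))).congr Filter.EventuallyEq.rfl ?_
  simp only [G3, mul_add, Finset.sum_add_distrib, zero_mul, zero_add, mul_zero, mul_ite, mul_one,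
    ite_self, add_zero, Finset.sum_ite_eq, Finset.sum_ite_eq', Finset.mem_univ, if_true]
  rw [add_sub_add_left_eq_sub]
  simp only [Finset.mul_sum, Finset.sum_mul, ← Finset.sum_neg_distrib, ← Finset.sum_sub_distrib]
  simp only [← Finset.sum_add_distrib]
  exact Finset.sum_congr rfl fun _ _ => by ring

end HorizontalDerivatives

/-! ### The radial contraction of the curvature -/

section RadialContraction

variable {e : Chart n M} {p : Cotangent n M} {g : BaseMetric n M} {D : BaseConnection n M}

theorem contMDiffAt_sum {I : Type*} {s : Finset I} {f : I → Cotangent n M → ℝ}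
    (hf : ∀ i ∈ s, ContMDiffAt (cotModel n) 𝓘(ℝ, ℝ) ∞ (f i) p) :
    ContMDiffAt (cotModel n) 𝓘(ℝ, ℝ) ∞ (fun q => ∑ i ∈ s, f i q) p :=
  ContMDiffAt.sum hf

theorem contMDiffAt_g0 (g : BaseMetric n M) (he : e ∈ IsManifold.maximalAtlas (𝓡 n) ∞ M)
    (hp : p.proj ∈ e.source) (i : Fin n) :
    ContMDiffAt (cotModel n) 𝓘(ℝ, ℝ) ∞ (g0 g e i) p :=
  contMDiffAt_sum fun h _ => (contMDiffAt_fibreCoord he hp h).mul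
    ((contMDiffAt_gInv g he hp h i).comp p (contMDiffAt_cotangent_proj p))

theorem contMDiffAt_energy (g : BaseMetric n M) (he : e ∈ IsManifold.maximalAtlas (𝓡 n) ∞ M)
    (hp : p.proj ∈ e.source) : ContMDiffAt (cotModel n) 𝓘(ℝ, ℝ) ∞ (energy g) p := by
  have h1 : ContMDiffAt (cotModel n) 𝓘(ℝ, ℝ) ∞
      (fun q => (∑ i, fibreCoord e i q * g0 g e i q) * (1 / 2)) p :=
    (contMDiffAt_sum fun i _ => (contMDiffAt_fibreCoord he hp i).mul
      (contMDiffAt_g0 g he hp i)).mul contMDiffAt_const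
  refine h1.congr_of_eventuallyEq ?_
  filter_upwards [eventually_proj_mem e hp] with q hq
  rw [energy_eq he hq, div_eq_mul_one_div]

theorem hasDirDeriv_energy_dp (g : BaseMetric n M) (he : e ∈ IsManifold.maximalAtlas (𝓡 n) ∞ M)
    (hp : p.proj ∈ e.source) (h : Fin n) :
    HasDirDeriv (cotModel n) p (dp e h p) (energy g) (g0 g e h p) := by
  have hg : ∀ i, HasDirDeriv (cotModel n) p (dp e h p) (g0 g e i) (gInv g e p.proj h i) :=
    fun i => (HasDirDeriv.sum (s := Finset.univ) fun l _ =>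
      (hasDirDeriv_fibreCoord_dp he hp l h).mul (hasDirDeriv_comp_proj_dp he hp
        ((contMDiffAt_gInv g he hp l i).mdifferentiableAt (by simp)) h)).congr
      Filter.EventuallyEq.rfl (by simp)
  refine ((HasDirDeriv.sum (s := Finset.univ) fun i _ =>
    (hasDirDeriv_fibreCoord_dp he hp i h).mul (hg i)).mul
      (HasDirDeriv.const (1 / 2))).congr ?_ ?_
  · filter_upwards [eventually_proj_mem e hp] with q hq
    rw [energy_eq he hq, div_eq_mul_one_div]
  · have h1 : ∑ i, fibreCoord e i p * gInv g e p.proj h i = g0 g e h p :=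
      Finset.sum_congr rfl fun i _ => by rw [gInv_symm g h i]
    simp [Finset.sum_add_distrib, h1]
    ring

/-- The curvature operator is skew, hence annihilates `g⁻¹(p, p)`. The energy density is constant
along horizontal fields, and so along their bracket, which is the curvature. -/
theorem sum_curv0_mul_g0 (hD : IsLeviCivita (fun x X Y => g.inner x X Y) D)
    (he : e ∈ IsManifold.maximalAtlas (𝓡 n) ∞ M) (hp : p.proj ∈ e.source) (i j : Fin n) :
    ∑ h, curv0 D e h i j p * g0 g e h p = 0 := by
  have h1 := mvfderiv_mlieBracket (contMDiffAt_energy g he hp) (diffFieldAt_delta hD he hp i)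
    (diffFieldAt_delta hD he hp j)
  rw [mlieBracket_delta_delta hD he hp, clm_map_sum_smul] at h1
  have h2 : ∀ i j, mvfderiv (cotModel n)
      (fun q => mvfderiv (cotModel n) (energy g) q (delta D e i q)) p (delta D e j p) = 0 := by
    intro i j
    refine ((HasDirDeriv.const 0).congr ?_ rfl).2
    filter_upwards [eventually_proj_mem e hp] with q hq
    exact (hasDirDeriv_energy_delta hD he hq i).2
  rw [h2, h2, sub_zero] at h1
  simpa only [(hasDirDeriv_energy_dp g he hp _).2, smul_eq_mul] using h1

end RadialContraction

/-! ### The Levi-Civita connection of the lifted metric in the adapted frame -/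

section ConnectionInFrame

variable {e : Chart n M} {p : Cotangent n M} {g : BaseMetric n M} {D : BaseConnection n M}
  {c : Coefficients} {N : CotConnection n M}

theorem frameComp_sum_smul {ι : Type*} (s : Finset ι) (u : ι → ℝ)
    (V : ι → TangentSpace (cotModel n) p) (k : Fin n ⊕ Fin n) :
    frameComp D e p (∑ h ∈ s, u h • V h) k = ∑ h ∈ s, u h * frameComp D e p (V h) k := by
  rcases k with k | k
  · simp only [frameComp, Sum.elim_inl, baseCoframe]
    rw [clm_map_sum_smul, clm_map_sum_smul]
    simp
  · simp only [frameComp, Sum.elim_inr]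
    change vertPartₗ D p _ _ = _
    rw [map_sum, _root_.sum_apply]
    simp only [map_smul, _root_.smul_apply, smul_eq_mul, vertPartₗ_apply]

theorem liftMetric_sum_smul_left {ι : Type*} (s : Finset ι) (u : ι → ℝ)
    (V : ι → TangentSpace (cotModel n) p) (χ : TangentSpace (cotModel n) p) :
    liftMetric g D c p (∑ h ∈ s, u h • V h) χ = ∑ h ∈ s, u h * liftMetric g D c p (V h) χ := by
  have he := IsManifold.chart_mem_maximalAtlas (I := 𝓡 n) (n := ∞) p.proj
  have hp := mem_chart_source (Coord n) p.proj
  simp only [liftMetric_eq D c he hp, dotProduct, frameComp_sum_smul, Finset.mul_sum,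
    Finset.sum_mul]
  rw [Finset.sum_comm]
  simp only [mul_assoc]

theorem liftMetric_bracket_dp_delta (hD : IsLeviCivita (fun x X Y => g.inner x X Y) D)
    (he : e ∈ IsManifold.maximalAtlas (𝓡 n) ∞ M) (hp : p.proj ∈ e.source) (i j : Fin n)
    (χ : TangentSpace (cotModel n) p) :
    liftMetric g D c p (VectorField.mlieBracket (cotModel n) (dp e i) (delta D e j) p) χ
      = ∑ h, christoffel D e i j h p.proj * liftMetric g D c p (dp e h p) χ := by
  rw [mlieBracket_dp_delta hD he hp, liftMetric_sum_smul_left]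

theorem liftMetric_bracket_delta_dp (hD : IsLeviCivita (fun x X Y => g.inner x X Y) D)
    (he : e ∈ IsManifold.maximalAtlas (𝓡 n) ∞ M) (hp : p.proj ∈ e.source) (i j : Fin n)
    (χ : TangentSpace (cotModel n) p) :
    liftMetric g D c p (VectorField.mlieBracket (cotModel n) (delta D e i) (dp e j) p) χ
      = -∑ h, christoffel D e j i h p.proj * liftMetric g D c p (dp e h p) χ := by
  rw [VectorField.mlieBracket_swap_apply, ← liftMetric_bracket_dp_delta hD he hp,
    ← zero_sub, liftMetric_sub_left, ← sub_self (0 : TangentSpace (cotModel n) p),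
    liftMetric_sub_left, sub_self, zero_sub]

theorem liftMetric_bracket_delta_delta (hD : IsLeviCivita (fun x X Y => g.inner x X Y) D)
    (he : e ∈ IsManifold.maximalAtlas (𝓡 n) ∞ M) (hp : p.proj ∈ e.source) (i j : Fin n)
    (χ : TangentSpace (cotModel n) p) :
    liftMetric g D c p (VectorField.mlieBracket (cotModel n) (delta D e i) (delta D e j) p) χ
      = ∑ h, curv0 D e h i j p * liftMetric g D c p (dp e h p) χ := by
  rw [mlieBracket_delta_delta hD he hp, liftMetric_sum_smul_left]

theorem liftMetric_bracket_dp_dp (D : BaseConnection n M)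
    (he : e ∈ IsManifold.maximalAtlas (𝓡 n) ∞ M) (hp : p.proj ∈ e.source) (i j : Fin n)
    (χ : TangentSpace (cotModel n) p) :
    liftMetric g D c p (VectorField.mlieBracket (cotModel n) (dp e i) (dp e j) p) χ = 0 := by
  rw [mlieBracket_dp_dp D he hp, ← sub_self (0 : TangentSpace (cotModel n) p),
    liftMetric_sub_left, sub_self]

theorem mvfderiv_liftMetric_dp_dp (D : BaseConnection n M) (c : Coefficients)
    (he : e ∈ IsManifold.maximalAtlas (𝓡 n) ∞ M) (hp : p.proj ∈ e.source) (i j : Fin n) :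
    mvfderiv (cotModel n) (fun q => liftMetric g D c q (dp e i q) (dp e j q)) p
      = mvfderiv (cotModel n) (G2 g c e i j) p :=
  mvfderiv_congr ((eventually_proj_mem e hp).mono fun _ hq => liftMetric_dp_dp D c he hq i j)

theorem mvfderiv_liftMetric_dp_delta (D : BaseConnection n M) (c : Coefficients)
    (he : e ∈ IsManifold.maximalAtlas (𝓡 n) ∞ M) (hp : p.proj ∈ e.source) (i j : Fin n) :
    mvfderiv (cotModel n) (fun q => liftMetric g D c q (dp e i q) (delta D e j q)) p
      = mvfderiv (cotModel n) (G3 g c e i j) p :=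
  mvfderiv_congr ((eventually_proj_mem e hp).mono fun _ hq => liftMetric_dp_delta D c he hq i j)

theorem mvfderiv_liftMetric_delta_dp (D : BaseConnection n M) (c : Coefficients)
    (he : e ∈ IsManifold.maximalAtlas (𝓡 n) ∞ M) (hp : p.proj ∈ e.source) (i j : Fin n) :
    mvfderiv (cotModel n) (fun q => liftMetric g D c q (delta D e i q) (dp e j q)) p
      = mvfderiv (cotModel n) (G3 g c e j i) p :=
  mvfderiv_congr ((eventually_proj_mem e hp).mono fun _ hq => liftMetric_delta_dp D c he hq i j)

theorem mvfderiv_liftMetric_delta_delta (D : BaseConnection n M) (c : Coefficients)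
    (he : e ∈ IsManifold.maximalAtlas (𝓡 n) ∞ M) (hp : p.proj ∈ e.source) (i j : Fin n) :
    mvfderiv (cotModel n) (fun q => liftMetric g D c q (delta D e i q) (delta D e j q)) p
      = mvfderiv (cotModel n) (G1 g c e i j) p :=
  mvfderiv_congr ((eventually_proj_mem e hp).mono fun _ hq => liftMetric_delta_delta D c he hq i j)

theorem koszul_liftMetric (hN : IsLeviCivita (liftMetric g D c) N)
    {X Y Z : ∀ q : Cotangent n M, TangentSpace (cotModel n) q} (hX : DiffFieldAt (cotModel n) X p)
    (hY : DiffFieldAt (cotModel n) Y p) (hZ : DiffFieldAt (cotModel n) Z p) :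
    2 * liftMetric g D c p (N Y p (X p)) (Z p)
      = mvfderiv (cotModel n) (fun q => liftMetric g D c q (Y q) (Z q)) p (X p)
        + mvfderiv (cotModel n) (fun q => liftMetric g D c q (X q) (Z q)) p (Y p)
        - mvfderiv (cotModel n) (fun q => liftMetric g D c q (X q) (Y q)) p (Z p)
        + liftMetric g D c p (VectorField.mlieBracket (cotModel n) X Y p) (Z p)
        - liftMetric g D c p (VectorField.mlieBracket (cotModel n) X Z p) (Y p)
        - liftMetric g D c p (VectorField.mlieBracket (cotModel n) Y Z p) (X p) :=
  hN.koszul (liftMetric_symm g D c) (liftMetric_sub_left g D c) hX hY hZ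

theorem liftMetric_dp_dp_dp (hN : IsLeviCivita (liftMetric g D c) N)
    (he : e ∈ IsManifold.maximalAtlas (𝓡 n) ∞ M) (hp : p.proj ∈ e.source) (i j k : Fin n) :
    liftMetric g D c p (N (dp e j) p (dp e i p)) (dp e k p)
      = (1 / 2) * (pd e i (G2 g c e j k) p + pd e j (G2 g c e i k) p
        - pd e k (G2 g c e i j) p) := by
  have h := koszul_liftMetric hN (diffFieldAt_dp he hp i) (diffFieldAt_dp he hp j)
    (diffFieldAt_dp he hp k)
  simp only [liftMetric_bracket_dp_dp D he hp, mvfderiv_liftMetric_dp_dp D c he hp] at h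
  simp only [pd]
  linarith

variable (hD : IsLeviCivita (fun x X Y => g.inner x X Y) D)
  (hN : IsLeviCivita (liftMetric g D c) N) (he : e ∈ IsManifold.maximalAtlas (𝓡 n) ∞ M)
  (hp : p.proj ∈ e.source)
include hD hN he hp

theorem liftMetric_dp_dp_delta (i j k : Fin n) :
    liftMetric g D c p (N (dp e j) p (dp e i p)) (delta D e k p)
      = (1 / 2) * (pd e i (G3 g c e j k) p + pd e j (G3 g c e i k) p) := by
  have h := koszul_liftMetric hN (diffFieldAt_dp he hp i) (diffFieldAt_dp he hp j)
    (diffFieldAt_delta hD he hp k)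
  simp only [liftMetric_bracket_dp_dp D he hp, mvfderiv_liftMetric_dp_dp D c he hp,
    mvfderiv_liftMetric_dp_delta D c he hp, liftMetric_bracket_dp_delta hD he hp,
    (hasDirDeriv_G2_delta hD he hp _ _ _).2, liftMetric_dp_dp D c he hp] at h
  have hs : ∀ l, G2 g c e l i p = G2 g c e i l p := fun l => G2_symm l i
  simp only [hs] at h
  simp only [pd]
  linarith

theorem liftMetric_dp_delta_dp (i j k : Fin n) :
    liftMetric g D c p (N (delta D e j) p (dp e i p)) (dp e k p)
      = (1 / 2) * (pd e i (G3 g c e k j) p - pd e k (G3 g c e i j) p) := by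
  have h := koszul_liftMetric hN (diffFieldAt_dp he hp i) (diffFieldAt_delta hD he hp j)
    (diffFieldAt_dp he hp k)
  simp only [liftMetric_bracket_dp_dp D he hp, mvfderiv_liftMetric_dp_dp D c he hp,
    mvfderiv_liftMetric_dp_delta D c he hp, mvfderiv_liftMetric_delta_dp D c he hp,
    liftMetric_bracket_dp_delta hD he hp, liftMetric_bracket_delta_dp hD he hp,
    (hasDirDeriv_G2_delta hD he hp _ _ _).2, liftMetric_dp_dp D c he hp] at h
  have hs : ∀ l, G2 g c e l i p = G2 g c e i l p := fun l => G2_symm l i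
  simp only [hs] at h
  simp only [pd]
  linarith

theorem liftMetric_dp_delta_delta (i j k : Fin n) :
    liftMetric g D c p (N (delta D e j) p (dp e i p)) (delta D e k p)
      = (1 / 2) * (pd e i (G1 g c e j k) p - ∑ l, curv0 D e l j k p * G2 g c e l i p) := by
  have h := koszul_liftMetric hN (diffFieldAt_dp he hp i) (diffFieldAt_delta hD he hp j)
    (diffFieldAt_delta hD he hp k)
  simp only [mvfderiv_liftMetric_delta_delta D c he hp, mvfderiv_liftMetric_dp_delta D c he hp,
    liftMetric_bracket_dp_delta hD he hp, liftMetric_bracket_delta_delta hD he hp,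
    (hasDirDeriv_G3_delta hD he hp _ _ _).2, liftMetric_dp_dp D c he hp,
    liftMetric_dp_delta D c he hp, christoffel_symm hD he hp _ k j] at h
  simp only [pd]
  linarith

/-- The Christoffel terms in `∇_{δ_i} δ_j` are subtracted, so that the rest is tensorial. -/
theorem liftMetric_delta_delta_dp (i j k : Fin n) :
    liftMetric g D c p (N (delta D e j) p (delta D e i p)
      - ∑ h, christoffel D e h i j p.proj • delta D e h p) (dp e k p)
      = (1 / 2) * (c.c₂ (energy g p) * (∑ l, gInv g e p.proj k l * curv0 D e l i j p)
        - pd e k (G1 g c e i j) p) := by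
  have h := koszul_liftMetric hN (diffFieldAt_delta hD he hp i) (diffFieldAt_delta hD he hp j)
    (diffFieldAt_dp he hp k)
  simp only [mvfderiv_liftMetric_delta_delta D c he hp, mvfderiv_liftMetric_delta_dp D c he hp,
    liftMetric_bracket_delta_dp hD he hp, liftMetric_bracket_delta_delta hD he hp,
    (hasDirDeriv_G3_delta hD he hp _ _ _).2, liftMetric_dp_dp D c he hp,
    liftMetric_dp_delta D c he hp, christoffel_symm hD he hp _ j i] at h
  -- the term with `d₂` contains `g^{0l} R^0_{lij} = 0`
  have h1 : ∑ l, curv0 D e l i j p * G2 g c e l k p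
      = c.c₂ (energy g p) * ∑ l, gInv g e p.proj k l * curv0 D e l i j p := by
    have h0 := sum_curv0_mul_g0 hD he hp i j
    have h2 : ∑ l, curv0 D e l i j p * G2 g c e l k p
        = c.c₂ (energy g p) * ∑ l, gInv g e p.proj k l * curv0 D e l i j p
          + c.d₂ (energy g p) * g0 g e k p * ∑ l, curv0 D e l i j p * g0 g e l p := by
      simp only [Finset.mul_sum, ← Finset.sum_add_distrib]
      refine Finset.sum_congr rfl fun l _ => ?_
      rw [G2, gInv_symm g l k]
      ring
    rw [h2, h0, mul_zero, add_zero]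
  rw [h1] at h
  rw [liftMetric_sub_left, liftMetric_sum_smul_left]
  simp only [liftMetric_delta_dp D c he hp, pd]
  linarith

/-- The Christoffel terms in `∇_{δ_i} δ_j` are subtracted, so that the rest is tensorial. -/
theorem liftMetric_delta_delta_delta (i j k : Fin n) :
    liftMetric g D c p (N (delta D e j) p (delta D e i p)
      - ∑ h, christoffel D e h i j p.proj • delta D e h p) (delta D e k p)
      = -(c.c₃ (energy g p) * curv0 D e i j k p) := by
  have h := koszul_liftMetric hN (diffFieldAt_delta hD he hp i) (diffFieldAt_delta hD he hp j)
    (diffFieldAt_delta hD he hp k)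
  simp only [mvfderiv_liftMetric_delta_delta D c he hp, liftMetric_bracket_delta_delta hD he hp,
    (hasDirDeriv_G1_delta hD he hp _ _ _).2, liftMetric_dp_delta D c he hp,
    christoffel_symm hD he hp _ j i, christoffel_symm hD he hp _ k i,
    christoffel_symm hD he hp _ k j] at h
  have hs : ∀ a l, G1 g c e a l p = G1 g c e l a p := fun a l => G1_symm a l
  -- the term with `d₃` contains `g^{0l} R^0_{lab} = 0`
  have h1 : ∀ a b d, ∑ l, curv0 D e l a b p * G3 g c e l d p
      = c.c₃ (energy g p) * curv0 D e d a b p := by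
    intro a b d
    have h0 := sum_curv0_mul_g0 hD he hp a b
    have h2 : ∑ l, curv0 D e l a b p * G3 g c e l d p
        = ∑ l, (if l = d then c.c₃ (energy g p) * curv0 D e l a b p else 0)
          + c.d₃ (energy g p) * fibreCoord e d p * ∑ l, curv0 D e l a b p * g0 g e l p := by
      simp only [Finset.mul_sum, ← Finset.sum_add_distrib]
      refine Finset.sum_congr rfl fun l _ => ?_
      rw [G3]
      split_ifs <;> ring
    rw [h2, h0, mul_zero, add_zero, Finset.sum_ite_eq', if_pos (Finset.mem_univ d)]
  -- by the first Bianchi identity the three curvature terms add up to `-2 c₃ R^0_{ijk}`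
  have h2 := curv0_bianchi hD he hp i j k
  have h3 := curv0_antisymm D he hp j i k
  simp only [h1, h3] at h
  simp only [hs i, hs j] at h
  rw [liftMetric_sub_left, liftMetric_sum_smul_left]
  simp only [liftMetric_delta_delta D c he hp]
  have h4 : curv0 D e k i j p = -curv0 D e i j k p - curv0 D e j k i p := by linarith
  rw [h4] at h
  linarith

end ConnectionInFrame

section ConnectionCoefficients

variable {e : Chart n M} {p : Cotangent n M} {g : BaseMetric n M} {D : BaseConnection n M}
  {c : Coefficients} {N : CotConnection n M}
  (hD : IsLeviCivita (fun x X Y => g.inner x X Y) D)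
  (hG : ∀ (p : Cotangent n M) (ξ : TangentSpace (cotModel n) p), ξ ≠ 0 →
    0 < liftMetric g D c p ξ ξ)
  (hN : IsLeviCivita (liftMetric g D c) N) (he : e ∈ IsManifold.maximalAtlas (𝓡 n) ∞ M)
  (hp : p.proj ∈ e.source)
include hD hG hN he hp

theorem covariantDerivative_dp_dp (i j : Fin n) :
    N (dp e j) p (dp e i p)
      = ∑ h, Q g c e i j h p • dp e h p + ∑ h, Qt g c e i j h p • delta D e h p := by
  refine (eq_sum_of_liftMetric he hp (hG p) (liftMetric_dp_dp_delta hD hN he hp i j)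
    (liftMetric_dp_dp_dp hN he hp i j)).trans ?_
  rw [add_comm]
  simp only [Q, Qt, mul_assoc, ← Finset.mul_sum]

theorem covariantDerivative_delta_dp (i j : Fin n) :
    N (delta D e j) p (dp e i p)
      = ∑ h, P g D c e j i h p • delta D e h p + ∑ h, Pt g D c e j i h p • dp e h p := by
  refine (eq_sum_of_liftMetric he hp (hG p) (liftMetric_dp_delta_delta hD hN he hp i j)
    (liftMetric_dp_delta_dp hD hN he hp i j)).trans ?_
  simp only [P, Pt, mul_assoc, ← Finset.mul_sum]

/-- This follows from the formula for `∇_{∂^j} δ_i` by the vanishing of the torsion. -/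
theorem covariantDerivative_dp_delta (i j : Fin n) :
    N (dp e j) p (delta D e i p)
      = ∑ h, (-christoffel D e j i h p.proj + Pt g D c e i j h p) • dp e h p
        + ∑ h, P g D c e i j h p • delta D e h p := by
  have h := hN.sub_eq_mlieBracket (diffFieldAt_dp he hp j) (diffFieldAt_delta hD he hp i)
  rw [mlieBracket_dp_delta hD he hp, sub_eq_iff_eq_add', ← sub_eq_iff_eq_add,
    covariantDerivative_delta_dp hD hG hN he hp] at h
  rw [← h]
  simp only [add_smul, neg_smul, Finset.sum_add_distrib, Finset.sum_neg_distrib]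
  abel

theorem covariantDerivative_delta_delta (i j : Fin n) :
    N (delta D e j) p (delta D e i p)
      = ∑ h, (christoffel D e h i j p.proj + St g D c e i j h p) • delta D e h p
        + ∑ h, S g D c e i j h p • dp e h p := by
  have h := eq_sum_of_liftMetric he hp (hG p) (liftMetric_delta_delta_delta hD hN he hp i j)
    (liftMetric_delta_delta_dp hD hN he hp i j)
  rw [sub_eq_iff_eq_add'] at h
  rw [h]
  simp only [S, St, add_smul, Finset.sum_add_distrib, mul_assoc, ← Finset.mul_sum, neg_mul,
    Finset.sum_neg_distrib, ← sub_eq_add_neg, add_assoc]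

end ConnectionCoefficients

/-! ### Change of charts -/

section ChangeOfCharts

variable {e e' : Chart n M} {p : Cotangent n M} {g : BaseMetric n M} {D : BaseConnection n M}
  {c : Coefficients} {N : CotConnection n M}

theorem mdifferentiableAt_transition (he : e ∈ IsManifold.maximalAtlas (𝓡 n) ∞ M)
    (he' : e' ∈ IsManifold.maximalAtlas (𝓡 n) ∞ M) {x : M} (hx : x ∈ e.source)
    (hx' : x ∈ e'.source) (i a : Fin n) (v : Variance) :
    MDifferentiableAt (𝓡 n) 𝓘(ℝ, ℝ) (fun y => transition e e' y i a v) x := by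
  have h : ∀ {e e' : Chart n M}, e ∈ IsManifold.maximalAtlas (𝓡 n) ∞ M →
      e' ∈ IsManifold.maximalAtlas (𝓡 n) ∞ M → x ∈ e.source → x ∈ e'.source → ∀ i a : Fin n,
      MDifferentiableAt (𝓡 n) 𝓘(ℝ, ℝ) (fun y => baseCoframe e' i y (baseFrame e a y)) x := by
    intro e e' he he' hx hx' i a
    have h1 := (contMDiffAt_mvfderiv_apply (contMDiffAt_chart_apply he' hx' i)
      (smoothFieldAt_baseFrame he hx a)).mdifferentiableAt (by simp)
    refine h1.congr_of_eventuallyEq ?_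
    filter_upwards [e'.open_source.mem_nhds hx'] with y hy
    exact (coordCovector_apply he' hy i _).symm
  cases v
  · exact h he he' hx hx' i a
  · exact h he' he hx' hx a i

theorem baseFrame_eq_sum_transition (he : e ∈ IsManifold.maximalAtlas (𝓡 n) ∞ M)
    {x : M} (hx : x ∈ e.source) (i : Fin n) :
    baseFrame e' i x = ∑ a, transition e e' x i a .lower • baseFrame e a x :=
  (sum_baseCoframe_smul he hx _).symm

theorem delta_eq_sum_transition (D : BaseConnection n M)
    (he : e ∈ IsManifold.maximalAtlas (𝓡 n) ∞ M) (he' : e' ∈ IsManifold.maximalAtlas (𝓡 n) ∞ M)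
    (hp : p.proj ∈ e.source) (hp' : p.proj ∈ e'.source) (i : Fin n) :
    delta D e' i p = ∑ a, transition e e' p.proj i a .lower • delta D e a p := by
  refine ext_projDeriv_vertPart D ?_ ?_
  · rw [projDeriv_delta D he' hp', clm_map_sum_smul]
    simp only [projDeriv_delta D he hp]
    exact baseFrame_eq_sum_transition he hp i
  · rw [vertPart_delta D he' hp', ← vertPartₗ_apply, map_sum]
    simp only [map_smul, vertPartₗ_apply, vertPart_delta D he hp, smul_zero,
      Finset.sum_const_zero]

theorem frameComp_inl_eq_sum_transition (he : e ∈ IsManifold.maximalAtlas (𝓡 n) ∞ M)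
    (he' : e' ∈ IsManifold.maximalAtlas (𝓡 n) ∞ M) (hp : p.proj ∈ e.source)
    (hp' : p.proj ∈ e'.source) (ξ : TangentSpace (cotModel n) p) (k : Fin n) :
    frameComp D e' p ξ (.inl k)
      = ∑ d, transition e e' p.proj k d .upper * frameComp D e p ξ (.inl d) := by
  simp only [frameComp, Sum.elim_inl]
  rw [← coordCovector_apply he' hp', clm_apply_eq_sum he hp]
  simp only [coordCovector_apply he' hp']
  rfl

theorem frameComp_inr_eq_sum_transition (he : e ∈ IsManifold.maximalAtlas (𝓡 n) ∞ M)
    (hp : p.proj ∈ e.source) (ξ : TangentSpace (cotModel n) p) (k : Fin n) :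
    frameComp D e' p ξ (.inr k)
      = ∑ d, transition e e' p.proj k d .lower * frameComp D e p ξ (.inr d) := by
  simp only [frameComp, Sum.elim_inr]
  rw [baseFrame_eq_sum_transition he hp k, clm_map_sum_smul]
  rfl

theorem dp_eq_sum_transition (D : BaseConnection n M)
    (he : e ∈ IsManifold.maximalAtlas (𝓡 n) ∞ M) (he' : e' ∈ IsManifold.maximalAtlas (𝓡 n) ∞ M)
    (hp : p.proj ∈ e.source) (hp' : p.proj ∈ e'.source) (i : Fin n) :
    dp e' i p = ∑ a, transition e e' p.proj i a .upper • dp e a p := by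
  have h1 : ∀ a, frameComp D e p (dp e' i p) (.inr a) = transition e e' p.proj i a .upper := by
    intro a
    rw [frameComp_inr_eq_sum_transition he' hp', frameComp_dp D he' hp']
    simp [Pi.single_apply]
    rfl
  have h2 : ∀ a, frameComp D e p (dp e' i p) (.inl a) = 0 := by
    intro a
    simp [frameComp, projDeriv_dp he' hp', baseCoframe]
  have h3 := frameComp_expansion D he hp (dp e' i p)
  simpa only [h1, h2, zero_smul, Finset.sum_const_zero, zero_add] using h3

/-- If a family of tangent vectors of `T*M`, one for each chart and pair of indices, transforms like a
tensor, then its components in the adapted frames are M-tensor fields. -/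
theorem isMTensorField_of_expansion {v₁ v₂ : Variance}
    {X Y : Chart n M → Fin n → Fin n → Fin n → Cotangent n M → ℝ}
    {F : Chart n M → Fin n → Fin n → ∀ p : Cotangent n M, TangentSpace (cotModel n) p}
    (hF : ∀ e ∈ IsManifold.maximalAtlas (𝓡 n) ∞ M, ∀ p : Cotangent n M, p.proj ∈ e.source →
      ∀ i j, F e i j p = ∑ h, X e i j h p • delta D e h p + ∑ h, Y e i j h p • dp e h p)
    (hT : ∀ e ∈ IsManifold.maximalAtlas (𝓡 n) ∞ M, ∀ e' ∈ IsManifold.maximalAtlas (𝓡 n) ∞ M,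
      ∀ p : Cotangent n M, p.proj ∈ e.source → p.proj ∈ e'.source → ∀ i j,
      F e' i j p = ∑ b, transition e e' p.proj j b v₂ •
        ∑ a, transition e e' p.proj i a v₁ • F e a b p) :
    IsMTensorField v₁ v₂ .upper X ∧ IsMTensorField v₁ v₂ .lower Y := by
  have hadd : ∀ (e : Chart n M) (p : Cotangent n M) (ξ ζ : TangentSpace (cotModel n) p),
      frameComp D e p (ξ + ζ) = frameComp D e p ξ + frameComp D e p ζ := by
    intro e p ξ ζ
    funext k
    simpa using frameComp_sum_smul (D := D) (e := e) Finset.univ (fun _ : Bool => (1 : ℝ))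
      (fun b => if b then ξ else ζ) k
  have hX : ∀ e ∈ IsManifold.maximalAtlas (𝓡 n) ∞ M, ∀ p : Cotangent n M, p.proj ∈ e.source →
      ∀ i j k, frameComp D e p (F e i j p) (.inl k) = X e i j k p := by
    intro e he p hp i j k
    rw [hF e he p hp, hadd, Pi.add_apply, frameComp_sum_smul, frameComp_sum_smul]
    simp [frameComp_delta D he hp, frameComp_dp D he hp, Pi.single_apply]
  have hY : ∀ e ∈ IsManifold.maximalAtlas (𝓡 n) ∞ M, ∀ p : Cotangent n M, p.proj ∈ e.source →
      ∀ i j k, frameComp D e p (F e i j p) (.inr k) = Y e i j k p := by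
    intro e he p hp i j k
    rw [hF e he p hp, hadd, Pi.add_apply, frameComp_sum_smul, frameComp_sum_smul]
    simp [frameComp_delta D he hp, frameComp_dp D he hp, Pi.single_apply]
  have hsum : ∀ (r s t : Fin n → ℝ) (T : Fin n → Fin n → Fin n → ℝ),
      ∑ d, t d * ∑ b, s b * ∑ a, r a * T a b d = ∑ a, ∑ b, ∑ d, r a * s b * t d * T a b d := by
    intro r s t T
    simp only [Finset.mul_sum]
    rw [Finset.sum_comm]
    conv_rhs => rw [Finset.sum_comm]
    refine Finset.sum_congr rfl fun b _ => ?_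
    rw [Finset.sum_comm]
    exact Finset.sum_congr rfl fun a _ => Finset.sum_congr rfl fun d _ => by ring
  constructor
  · intro e he e' he' p hp hp' i j k
    rw [← hX e' he' p hp', frameComp_inl_eq_sum_transition he he' hp hp', hT e he e' he' p hp hp',
      ← hsum]
    simp only [frameComp_sum_smul, hX e he p hp]
  · intro e he e' he' p hp hp' i j k
    rw [← hY e' he' p hp', frameComp_inr_eq_sum_transition he hp, hT e he e' he' p hp hp',
      ← hsum]
    simp only [frameComp_sum_smul, hY e he p hp]

/-- The Jacobian matrix is constant in vertical directions and passes through the derivative. -/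
theorem covariantDerivative_dp_change (D : BaseConnection n M) (N : CotConnection n M)
    (he : e ∈ IsManifold.maximalAtlas (𝓡 n) ∞ M) (he' : e' ∈ IsManifold.maximalAtlas (𝓡 n) ∞ M)
    (hp : p.proj ∈ e.source) (hp' : p.proj ∈ e'.source) (j : Fin n)
    {ξ : TangentSpace (cotModel n) p} (hξ : projDeriv p ξ = 0) :
    N (dp e' j) p ξ = ∑ b, transition e e' p.proj j b .upper • N (dp e b) p ξ := by
  have hτ := fun b => mdifferentiableAt_transition he he' hp hp' j b .upper
  have h1 : N (dp e' j) p
      = N (fun q => ∑ b, transition e e' q.proj j b .upper • dp e b q) p := by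
    refine covariantDerivative_congr N (diffFieldAt_dp he' hp' j) ?_
    filter_upwards [eventually_proj_mem e hp, eventually_proj_mem e' hp'] with q hq hq'
    exact dp_eq_sum_transition D he he' hq hq' j
  rw [h1, covariantDerivative_sum_smul N Finset.univ
    (f := fun b (q : Cotangent n M) => transition e e' q.proj j b .upper)
    (fun b => (hτ b).comp p (mdifferentiableAt_proj p)) (fun b => diffFieldAt_dp he hp b)]
  refine Finset.sum_congr rfl fun b _ => ?_
  rw [mvfderiv_comp_proj (f := fun x => transition e e' x j b .upper) (hτ b), hξ, map_zero,
    zero_smul, add_zero]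

theorem covariantDerivative_delta_change (hD : IsLeviCivita (fun x X Y => g.inner x X Y) D)
    (N : CotConnection n M) (he : e ∈ IsManifold.maximalAtlas (𝓡 n) ∞ M)
    (he' : e' ∈ IsManifold.maximalAtlas (𝓡 n) ∞ M) (hp : p.proj ∈ e.source)
    (hp' : p.proj ∈ e'.source) (j : Fin n) (ξ : TangentSpace (cotModel n) p) :
    N (delta D e' j) p ξ
      = ∑ b, transition e e' p.proj j b .lower • N (delta D e b) p ξ
        + ∑ b, mvfderiv (𝓡 n) (fun x => transition e e' x j b .lower) p.proj (projDeriv p ξ)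
          • delta D e b p := by
  have hτ := fun b => mdifferentiableAt_transition he he' hp hp' j b .lower
  have h1 : N (delta D e' j) p
      = N (fun q => ∑ b, transition e e' q.proj j b .lower • delta D e b q) p := by
    refine covariantDerivative_congr N (diffFieldAt_delta hD he' hp' j) ?_
    filter_upwards [eventually_proj_mem e hp, eventually_proj_mem e' hp'] with q hq hq'
    exact delta_eq_sum_transition D he he' hq hq' j
  rw [h1, covariantDerivative_sum_smul N Finset.univ
    (f := fun b (q : Cotangent n M) => transition e e' q.proj j b .lower)
    (fun b => (hτ b).comp p (mdifferentiableAt_proj p)) (fun b => diffFieldAt_delta hD he hp b),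
    ← Finset.sum_add_distrib]
  refine Finset.sum_congr rfl fun b _ => ?_
  rw [mvfderiv_comp_proj (f := fun x => transition e e' x j b .lower) (hτ b)]

theorem covariantDerivative_baseFrame_change (D : BaseConnection n M)
    (he : e ∈ IsManifold.maximalAtlas (𝓡 n) ∞ M) (he' : e' ∈ IsManifold.maximalAtlas (𝓡 n) ∞ M)
    {x : M} (hx : x ∈ e.source) (hx' : x ∈ e'.source) (j : Fin n) (X : TangentSpace (𝓡 n) x) :
    D (baseFrame e' j) x X
      = ∑ b, transition e e' x j b .lower • D (baseFrame e b) x X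
        + ∑ b, mvfderiv (𝓡 n) (fun x => transition e e' x j b .lower) x X
          • baseFrame e b x := by
  have h1 : D (baseFrame e' j) x
      = D (fun y => ∑ b, transition e e' y j b .lower • baseFrame e b y) x := by
    refine covariantDerivative_congr D (diffFieldAt_baseFrame he' hx' j) ?_
    filter_upwards [e.open_source.mem_nhds hx] with y hy
    exact baseFrame_eq_sum_transition he hy j
  rw [h1, covariantDerivative_sum_smul D Finset.univ
    (f := fun b y => transition e e' y j b .lower)
    (fun b => mdifferentiableAt_transition he he' hx hx' j b .lower)
    (fun b => diffFieldAt_baseFrame he hx b), ← Finset.sum_add_distrib]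

/-- The horizontal lift of `∇_{∂_i} ∂_j`. The inhomogeneous terms in its transformation law are those
of `∇_{δ_i} δ_j`. -/
def horizontalChristoffel (D : BaseConnection n M) (e : Chart n M) (i j : Fin n)
    (p : Cotangent n M) : TangentSpace (cotModel n) p :=
  ∑ h, christoffel D e h i j p.proj • delta D e h p

theorem horizontalChristoffel_change (D : BaseConnection n M)
    (he : e ∈ IsManifold.maximalAtlas (𝓡 n) ∞ M) (he' : e' ∈ IsManifold.maximalAtlas (𝓡 n) ∞ M)
    (hp : p.proj ∈ e.source) (hp' : p.proj ∈ e'.source) (i j : Fin n) :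
    horizontalChristoffel D e' i j p
      = ∑ b, transition e e' p.proj j b .lower •
          ∑ a, transition e e' p.proj i a .lower • horizontalChristoffel D e a b p
        + ∑ b, mvfderiv (𝓡 n) (fun x => transition e e' x j b .lower) p.proj
          (baseFrame e' i p.proj) • delta D e b p := by
  have hproj : ∀ {e : Chart n M}, e ∈ IsManifold.maximalAtlas (𝓡 n) ∞ M → p.proj ∈ e.source →
      ∀ i j, projDeriv p (horizontalChristoffel D e i j p)
        = D (baseFrame e j) p.proj (baseFrame e i p.proj) := by
    intro e he hp i j
    rw [horizontalChristoffel, clm_map_sum_smul, covariantDerivative_baseFrame D he hp]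
    simp only [projDeriv_delta D he hp]
  have hvert : ∀ {e : Chart n M}, e ∈ IsManifold.maximalAtlas (𝓡 n) ∞ M → p.proj ∈ e.source →
      ∀ i j, vertPartₗ D p (horizontalChristoffel D e i j p) = 0 := by
    intro e he hp i j
    rw [horizontalChristoffel, map_sum]
    simp only [map_smul, vertPartₗ_apply, vertPart_delta D he hp, smul_zero,
      Finset.sum_const_zero]
  refine ext_projDeriv_vertPart D ?_ ?_
  · rw [hproj he' hp', clm_map_add, clm_map_sum_smul, clm_map_sum_smul,
      covariantDerivative_baseFrame_change D he he' hp hp']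
    simp only [clm_map_sum_smul, hproj he hp, projDeriv_delta D he hp]
    congr 1
    refine Finset.sum_congr rfl fun b _ => ?_
    rw [baseFrame_eq_sum_transition (e' := e') he hp i, clm_map_sum_smul]
  · rw [← vertPartₗ_apply, ← vertPartₗ_apply, hvert he' hp', map_add, map_sum, map_sum]
    simp only [map_smul, map_sum, hvert he hp, vertPartₗ_apply, vertPart_delta D he hp, smul_zero,
      Finset.sum_const_zero, add_zero]

variable (hD : IsLeviCivita (fun x X Y => g.inner x X Y) D)
  (hG : ∀ (p : Cotangent n M) (ξ : TangentSpace (cotModel n) p), ξ ≠ 0 →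
    0 < liftMetric g D c p ξ ξ)
  (hN : IsLeviCivita (liftMetric g D c) N)
include hD hG hN

theorem isMTensorField_dp_dp :
    IsMTensorField .upper .upper .upper (Qt (M := M) g c) ∧
      IsMTensorField .upper .upper .lower (Q (M := M) g c) := by
  refine isMTensorField_of_expansion (D := D) (F := fun e i j p => N (dp e j) p (dp e i p)) ?_ ?_
  · intro e he p hp i j
    rw [covariantDerivative_dp_dp hD hG hN he hp, add_comm]
  · intro e he e' he' p hp hp' i j
    rw [covariantDerivative_dp_change D N he he' hp hp' j (projDeriv_dp he' hp' i)]
    refine Finset.sum_congr rfl fun b _ => ?_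
    rw [dp_eq_sum_transition D he he' hp hp' i, clm_map_sum_smul]

theorem isMTensorField_delta_dp :
    IsMTensorField .lower .upper .upper (P g D c) ∧
      IsMTensorField .lower .upper .lower (Pt g D c) := by
  refine isMTensorField_of_expansion (D := D)
    (F := fun e j i p => N (delta D e j) p (dp e i p)) ?_ ?_
  · intro e he p hp j i
    exact covariantDerivative_delta_dp hD hG hN he hp i j
  · intro e he e' he' p hp hp' j i
    rw [covariantDerivative_delta_change hD N he he' hp hp' j, projDeriv_dp he' hp']
    simp only [map_zero, zero_smul, Finset.sum_const_zero, add_zero]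
    rw [dp_eq_sum_transition D he he' hp hp' i]
    simp only [clm_map_sum_smul, Finset.smul_sum]
    rw [Finset.sum_comm]
    simp only [smul_comm (transition e e' p.proj j _ _)]

theorem isMTensorField_delta_delta :
    IsMTensorField .lower .lower .upper (St g D c) ∧
      IsMTensorField .lower .lower .lower (S g D c) := by
  refine isMTensorField_of_expansion (D := D)
    (F := fun e i j p => N (delta D e j) p (delta D e i p) - horizontalChristoffel D e i j p)
    ?_ ?_
  · intro e he p hp i j
    rw [covariantDerivative_delta_delta hD hG hN he hp, horizontalChristoffel]
    simp only [add_smul, Finset.sum_add_distrib]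
    abel
  · intro e he e' he' p hp hp' i j
    rw [covariantDerivative_delta_change hD N he he' hp hp' j, projDeriv_delta D he' hp',
      horizontalChristoffel_change D he he' hp hp', add_sub_add_right_eq_sub,
      ← Finset.sum_sub_distrib]
    refine Finset.sum_congr rfl fun b _ => ?_
    rw [← smul_sub, delta_eq_sum_transition D he he' hp hp' i, clm_map_sum_smul,
      ← Finset.sum_sub_distrib]
    simp only [smul_sub]

end ChangeOfCharts

end

end NaturalLift

open NaturalLift in
theorem theorem3p1 {n : ℕ} {M : Type*} [TopologicalSpace M]
    [ChartedSpace (EuclideanSpace ℝ (Fin n)) M] [IsManifold (𝓡 n) ∞ M]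
    -- a Riemannian metric `g` on `M` and its Levi-Civita connection `D`
    (g : BaseMetric n M) (D : BaseConnection n M)
    (hD : IsLeviCivita (fun x X Y => g.inner x X Y) D)
    -- a general natural lifted metric `G` which is Riemannian, and its Levi-Civita connection `N`
    (c : Coefficients)
    (hG : ∀ (p : Cotangent n M) (ξ : TangentSpace (cotModel n) p), ξ ≠ 0 →
      0 < liftMetric g D c p ξ ξ)
    (N : CotConnection n M) (hN : IsLeviCivita (liftMetric g D c) N) :
    (∀ e ∈ IsManifold.maximalAtlas (𝓡 n) ∞ M, ∀ p : Cotangent n M, p.proj ∈ e.source →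
      ∀ i j : Fin n,
        N (dp e j) p (dp e i p)
            = ∑ h, Q g c e i j h p • dp e h p + ∑ h, Qt g c e i j h p • delta D e h p ∧
        N (dp e j) p (delta D e i p)
            = ∑ h, (-christoffel D e j i h p.proj + Pt g D c e i j h p) • dp e h p
              + ∑ h, P g D c e i j h p • delta D e h p ∧
        N (delta D e j) p (dp e i p)
            = ∑ h, P g D c e j i h p • delta D e h p + ∑ h, Pt g D c e j i h p • dp e h p ∧
        N (delta D e j) p (delta D e i p)
            = ∑ h, (christoffel D e h i j p.proj + St g D c e i j h p) • delta D e h p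
              + ∑ h, S g D c e i j h p • dp e h p) ∧
    IsMTensorField .upper .upper .lower (Q (M := M) g c) ∧
    IsMTensorField .upper .upper .upper (Qt (M := M) g c) ∧
    IsMTensorField .lower .upper .upper (P g D c) ∧
    IsMTensorField .lower .upper .lower (Pt g D c) ∧
    IsMTensorField .lower .lower .lower (S g D c) ∧
    IsMTensorField .lower .lower .upper (St g D c) := by
  refine ⟨fun e he p hp i j => ⟨covariantDerivative_dp_dp hD hG hN he hp i j,
    covariantDerivative_dp_delta hD hG hN he hp i j, covariantDerivative_delta_dp hD hG hN he hp i j,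
    covariantDerivative_delta_delta hD hG hN he hp i j⟩, ?_⟩
  have h1 := isMTensorField_dp_dp hD hG hN
  have h2 := isMTensorField_delta_dp hD hG hN
  have h3 := isMTensorField_delta_delta hD hG hN
  exact ⟨h1.2, h1.1, h2.1, h2.2, h3.2, h3.1⟩
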